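/- Let $-\infty\le\alpha<\beta<-1$, and let $\mu$ be a positive Borel measure on $\mathbb R$ whose support is infinite and contained in $[\alpha,\beta]$, such that the Markov function $$f(z)=f^{[\mu]}(z)=\int\frac{d\mu(x)}{z-x}$$ is given by an absolutely convergent integral for every $z\in\mathbb C\setminus[\alpha,\beta]$ (here $[\alpha,\beta]$ means $(-\infty,\beta]$ if $\alpha=-\infty$). Let $m\ge 1$ and let $z_1,\dots,z_{2m}\in\mathbb C\setminus[\alpha,\beta]$, not necessarily distinct, be such that non-real points occur in conjugate pairs (that is, $w$ and $\overline w$ have the same multiplicity for every $w$). Then there is exactly one rational function $r_m$ with numerator degree at most $m-1$ and denominator degree at most $m$ that interpolates $f$ at $z_1,\dots,z_{2m}$ in the sense of Hermite: $r_m$ has no pole at any $z_j$, and at a point of multiplicity $k$ the derivatives of order $0,\dots,k-1$ of $r_m$ and $f$ agree. This $r_m$ has no pole in the closed unit disk $\overline{\mathbb D}$, and, with $$C=\frac{1-\beta}{-1-\beta}\,f(-1),$$ the following bounds hold. (a) If all interpolation points have even multiplicity, then $$\max_{z\in\overline{\mathbb D}}|f(z)-r_m(z)|\le C\,\max_{x\in[\alpha,\beta]}\Bigl|\prod_{j=1}^{2m}\frac{1-xz_j}{x-z_j}\Bigr|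 ,$$ where for $\alpha=-\infty$ the maximum is understood as the (finite) supremum over real $x\le\beta$. (b) In general (for arbitrary multiplicities), $$\max_{z\in\overline{\mathbb D}}|f(z)-r_m(z)|\le C\,\frac{4\,\eta'_{2m}}{(1-\eta'_{2m})^2},\qquad \eta'_{2m}=\max_{z\in\overline{\mathbb D}}|G_{2m}(z)|<1,\qquad G_{2m}(z)=\prod_{j=1}^{2m}\frac{\varphi(z)-\varphi(z_j)}{1-\varphi(z)\varphi(z_j)} .$$ Here $\varphi$ is the conformal map, symmetric with respect to the real axis, of $\overline{\mathbb C}\setminus[\alpha,\beta]$ (of $\mathbb C\setminus(-\infty,\beta]$ if $\alpha=-\infty$) onto the exterior $\{|w|>1\}\cup\{\infty\}$ of the closed unit disk given by $$\varphi(z)=\frac{1+s(z)}{1-s(z)},\qquad s(z)=\sqrt{\frac{z-\beta}{z-\alpha}}\quad\Bigl(s(z)=\sqrt{z-\beta}\ \text{ if }\alpha=-\infty\Bigr),$$ with the principal square root. Factors in which $\varphi(z)$ or $\varphi(z_j)$ is $\infty$ are understood as limits; $G_{2m}$ does not depend on which real-symmetric conformal map is chosen. -/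

import Mathlib

open MeasureTheory Polynomial
open scoped ComplexConjugate

/-- The real interval `[α, β]`, where `α = -∞` (that is `⊥ : EReal`) is allowed. -/
def realCut (α : EReal) (β : ℝ) : Set ℝ := {x : ℝ | α ≤ (x : EReal) ∧ x ≤ β}

/-- The interval `[α, β]` as a subset of the complex plane. -/
def complexCut (α : EReal) (β : ℝ) : Set ℂ := (fun x : ℝ => (x : ℂ)) '' realCut α β

/-- The Cauchy transform `z ↦ ∫ dμ(x) / (z - x)`. -/
noncomputable def markovFunction (μ : Measure ℝ) (z : ℂ) : ℂ := ∫ x : ℝ, 1 / (z - (x : ℂ)) ∂μ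

/-- `μ` is a (positive) measure which generates a Markov function on `ℂ ∖ [α, β]`: its support is
infinite and contained in `[α, β]`, and the Cauchy transform is a convergent integral off `[α, β]`.
For `α > -∞` the last condition says that `μ` is finite; for `α = -∞` infinite measures such as
`|x| ^ γ dx` on `(-∞, β]`, `-1 < γ < 0`, are allowed. -/
structure IsMarkovMeasure (α : EReal) (β : ℝ) (μ : Measure ℝ) : Prop where
  support_subset : μ.support ⊆ realCut α β
  support_infinite : μ.support.Infinite
  integrable : ∀ z : ℂ, z ∉ complexCut α β → Integrable (fun x : ℝ => 1 / (z - (x : ℂ))) μ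

/-- The multiplicity of `w` in the finite family of points `z`. -/
noncomputable def pointMult {n : ℕ} (z : Fin n → ℂ) (w : ℂ) : ℕ := Nat.card {j : Fin n // z j = w}

/-- The value of a rational function at a complex number that is not one of its poles. -/
noncomputable def ratValue (r : RatFunc ℂ) (w : ℂ) : ℂ := r.eval (RingHom.id ℂ) w

/-- `w` is a pole of the rational function `r` (a zero of its reduced denominator). -/
def IsRatPole (r : RatFunc ℂ) (w : ℂ) : Prop := r.denom.IsRoot w

/-- `r` is a rational interpolant of type `[m-1|m]` (for `m ≥ 1`) of `f` at `z_1, …, z_{2m}`: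
numerator degree at most `m - 1`, denominator degree at most `m`, no pole at an interpolation
point, and at each `z_j` of multiplicity `k` the derivatives of order `0, …, k - 1` of `r` and `f`
agree. -/
structure IsRationalInterpolant (f : ℂ → ℂ) (m : ℕ) (z : Fin (2 * m) → ℂ) (r : RatFunc ℂ) :
    Prop where
  natDegree_num_le : r.num.natDegree ≤ m - 1
  natDegree_denom_le : r.denom.natDegree ≤ m
  not_pole : ∀ j, ¬ IsRatPole r (z j)
  interpolates : ∀ j, ∀ k < pointMult z (z j),
    iteratedDeriv k (ratValue r) (z j) = iteratedDeriv k f (z j)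

/-- The Möbius map `(z - β) / (z - α)` (read as `z - β` if `α = -∞`), which takes `ℂ ∖ [α, β]` into
the plane slit along `(-∞, 0]`. -/
noncomputable def cutQuotient (α : EReal) (β : ℝ) (z : ℂ) : ℂ :=
  if α = ⊥ then z - (β : ℂ) else (z - (β : ℂ)) / (z - ((α.toReal : ℝ) : ℂ))

/-- With `s` the principal square root of `(z - β) / (z - α)`, the conformal map of the complement
of `[α, β]` in the Riemann sphere onto the exterior of the closed unit disk is
`φ(z) = (1 + s) / (1 - s)`; it is symmetric with respect to the real axis, and for `α > -∞` it is
normalized by `φ(∞) = ∞`. Equivalently `z = T((φ + 1 / φ) / 2)` with `T` the real Möbius map with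
`(T⁻¹(z) - 1) / (T⁻¹(z) + 1) = (z - β) / (z - α)`. Since `φ` takes the value `∞`, we work with its
reciprocal `1 / φ = (1 - s) / (1 + s)`, whose values lie in the open unit disk; see
`invPhi_conformal` below. -/
noncomputable def invPhi (α : EReal) (β : ℝ) (z : ℂ) : ℂ :=
  (1 - cutQuotient α β z ^ (1 / 2 : ℂ)) / (1 + cutQuotient α β z ^ (1 / 2 : ℂ))

/-- The product `G(z) = ∏ (φ(z) - φ(z_j)) / (1 - φ(z) φ(z_j))`, written in terms of `u = 1 / φ`:
each factor equals `(u(z) - u(z_j)) / (1 - u(z) u(z_j))`, which also makes sense where `φ = ∞`. -/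
noncomputable def blaschkeG (α : EReal) (β : ℝ) {n : ℕ} (z : Fin n → ℂ) (w : ℂ) : ℂ :=
  ∏ j, (invPhi α β w - invPhi α β (z j)) / (1 - invPhi α β w * invPhi α β (z j))

/-- The values of `|G|` on the closed unit disk. -/
def diskValues (α : EReal) (β : ℝ) {n : ℕ} (z : Fin n → ℂ) : Set ℝ :=
  (fun w => ‖blaschkeG α β z w‖) '' Metric.closedBall (0 : ℂ) 1

/-- The maximum of `|G|` on the closed unit disk. -/
noncomputable def etaDisk (α : EReal) (β : ℝ) {n : ℕ} (z : Fin n → ℂ) : ℝ :=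
  sSup (diskValues α β z)

/-- The values of `|∏ (1 - x z_j) / (x - z_j)|` for real `x` in `[α, β]`. -/
def cutValues (α : EReal) (β : ℝ) {n : ℕ} (z : Fin n → ℂ) : Set ℝ :=
  (fun x : ℝ => ‖∏ j, (1 - (x : ℂ) * z j) / ((x : ℂ) - z j)‖) '' realCut α β

/-- The maximum of `|∏ (1 - x z_j) / (x - z_j)|` on `[α, β]`; if `α = -∞`, the value at the end
point `∞` is the limit `|∏ z_j|`, so that the maximum is the supremum over the real points. -/
noncomputable def cutMax (α : EReal) (β : ℝ) {n : ℕ} (z : Fin n → ℂ) : ℝ :=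
  sSup (cutValues α β z)

/-- The constant `C = (1 - β) / (-1 - β) · f(-1)` with `f` the Markov function of `μ`
(`f(-1)` is a real number). -/
noncomputable def diskConst (β : ℝ) (μ : Measure ℝ) : ℝ :=
  (1 - β) / (-1 - β) * (markovFunction μ (-1)).re

theorem cutQuotient_mem_slitPlane {α : EReal} {β : ℝ} (hαβ : α < (β : EReal)) {z : ℂ}
    (hz : z ∉ complexCut α β) : cutQuotient α β z ∈ Complex.slitPlane := by
  induction α using EReal.rec with
  | bot =>
    rw [cutQuotient, if_pos rfl, Complex.mem_slitPlane_iff_not_le_zero, Complex.le_def]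
    rintro ⟨h1, h2⟩
    refine hz ⟨z.re, ⟨bot_le, by simpa using h1⟩, ?_⟩
    apply Complex.ext <;> simp_all
  | top => exact absurd hαβ (by simp)
  | coe a =>
    have hab : a < β := by exact_mod_cast hαβ
    have hza : z - (a : ℂ) ≠ 0 := fun h => hz ⟨a, ⟨le_refl _, hab.le⟩, (sub_eq_zero.1 h).symm⟩
    rw [cutQuotient, if_neg (by simp), EReal.toReal_coe, Complex.mem_slitPlane_iff_not_le_zero]
    intro h
    obtain ⟨t, ht⟩ : ∃ t : ℝ, (z - β) / (z - a) = (-t : ℝ) := by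
      refine ⟨-((z - β) / (z - a)).re, ?_⟩
      rw [Complex.le_def] at h
      apply Complex.ext <;> simp_all
    have ht0 : 0 ≤ t := by
      rw [ht] at h
      have : (-t : ℝ) ≤ 0 := by exact_mod_cast h
      linarith
    rw [div_eq_iff hza] at ht
    have h1 : (1 + t : ℂ) ≠ 0 := by
      have : (1 + t : ℝ) ≠ 0 := by positivity
      exact_mod_cast this
    refine hz ⟨(β + t * a) / (1 + t), ⟨?_, ?_⟩, ?_⟩
    · rw [EReal.coe_le_coe_iff, le_div_iff₀ (by positivity)]; nlinarith
    · rw [div_le_iff₀ (by positivity)]; nlinarith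
    · push_cast at ht ⊢
      rw [div_eq_iff h1]
      linear_combination -ht

/-- A Möbius map is determined by its values: `cutQuotient` is injective off `[α, β]`. -/
theorem cutQuotient_injOn {α : EReal} {β : ℝ} (hαβ : α < (β : EReal)) :
    Set.InjOn (cutQuotient α β) (complexCut α β)ᶜ := by
  intro z hz w hw h
  induction α using EReal.rec with
  | bot => simpa [cutQuotient] using h
  | top => exact absurd hαβ (by simp)
  | coe a =>
    have hab : a < β := by exact_mod_cast hαβ
    have hne : ∀ v ∈ (complexCut (a : EReal) β)ᶜ, v - (a : ℂ) ≠ 0 := fun v hv h =>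
      hv ⟨a, ⟨le_refl _, hab.le⟩, (sub_eq_zero.1 h).symm⟩
    simp only [cutQuotient, if_neg (EReal.coe_ne_bot a), EReal.toReal_coe] at h
    rw [div_eq_div_iff (hne z hz) (hne w hw)] at h
    have hb : (β - a : ℂ) ≠ 0 := by
      have : (β - a : ℝ) ≠ 0 := by linarith
      exact_mod_cast this
    apply mul_left_cancel₀ hb
    linear_combination h

theorem re_cpow_half_pos {q : ℂ} (hq : q ∈ Complex.slitPlane) : 0 < (q ^ (1 / 2 : ℂ)).re := by
  have hq0 := Complex.slitPlane_ne_zero hq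
  rw [Complex.cpow_def_of_ne_zero hq0, Complex.exp_re]
  have him : (Complex.log q * (1 / 2)).im = q.arg / 2 := by
    rw [mul_one_div, show (2 : ℂ) = ((2 : ℝ) : ℂ) by norm_num, Complex.div_ofReal_im,
      Complex.log_im]
  rw [him]
  have h1 := Complex.neg_pi_lt_arg q
  have h2 := lt_of_le_of_ne (Complex.arg_le_pi q) (Complex.mem_slitPlane_iff_arg.1 hq).1
  exact mul_pos (Real.exp_pos _) (Real.cos_pos_of_mem_Ioo ⟨by linarith, by linarith⟩)

theorem cpow_half_sq (q : ℂ) : (q ^ (1 / 2 : ℂ)) ^ 2 = q := by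
  rw [← Complex.cpow_mul_nat]; norm_num

theorem norm_one_sub_lt {s : ℂ} (hs : 0 < s.re) : ‖1 - s‖ < ‖1 + s‖ := by
  rw [← sq_lt_sq₀ (norm_nonneg _) (norm_nonneg _), Complex.sq_norm, Complex.sq_norm,
    Complex.normSq_apply, Complex.normSq_apply]
  simp only [Complex.sub_re, Complex.add_re, Complex.sub_im, Complex.add_im, Complex.one_re,
    Complex.one_im]
  nlinarith

/-- `1 / φ` is holomorphic and injective on `ℂ ∖ [α, β]`, commutes with complex conjugation, and
its image is the open unit disk, without the point `0 = 1 / φ(∞)` if `α > -∞`. -/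
theorem invPhi_conformal {α : EReal} {β : ℝ} (hαβ : α < (β : EReal)) :
    DifferentiableOn ℂ (invPhi α β) (complexCut α β)ᶜ ∧
    Set.InjOn (invPhi α β) (complexCut α β)ᶜ ∧
    (∀ z ∉ complexCut α β, invPhi α β (conj z) = conj (invPhi α β z)) ∧
    invPhi α β '' (complexCut α β)ᶜ =
      {u : ℂ | ‖u‖ < 1 ∧ (α ≠ ⊥ → u ≠ 0)} := by
  have hre : ∀ z ∉ complexCut α β, 0 < (cutQuotient α β z ^ (1 / 2 : ℂ)).re := fun z hz =>
    re_cpow_half_pos (cutQuotient_mem_slitPlane hαβ hz)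
  have hne : ∀ s : ℂ, 0 < s.re → 1 + s ≠ 0 := fun s hs h => by
    have := congrArg Complex.re h
    simp at this
    linarith
  have hcutne : ∀ a : ℝ, α = a → ∀ z ∉ complexCut α β, z - (a : ℂ) ≠ 0 := by
    rintro a rfl z hz h
    exact hz ⟨a, ⟨le_refl _, by exact_mod_cast hαβ.le⟩, (sub_eq_zero.1 h).symm⟩
  refine ⟨?_, ?_, ?_, ?_⟩
  · have hq : DifferentiableOn ℂ (cutQuotient α β) (complexCut α β)ᶜ := by
      induction α using EReal.rec with
      | bot =>
        have : cutQuotient ⊥ β = fun z => z - (β : ℂ) := by funext z; simp [cutQuotient]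
        rw [this]; fun_prop
      | top => exact absurd hαβ (by simp)
      | coe a =>
        have : cutQuotient a β = fun z => (z - (β : ℂ)) / (z - (a : ℂ)) := by
          funext z; simp [cutQuotient]
        rw [this]
        exact DifferentiableOn.div (by fun_prop) (by fun_prop) (hcutne a rfl)
    have hs : DifferentiableOn ℂ (fun z => cutQuotient α β z ^ (1 / 2 : ℂ)) (complexCut α β)ᶜ :=
      fun z hz => (hq z hz).cpow (differentiableWithinAt_const _)
        (cutQuotient_mem_slitPlane hαβ hz)
    exact ((differentiableOn_const 1).sub hs).div ((differentiableOn_const 1).add hs)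
      (fun z hz => hne _ (hre z hz))
  · intro z hz w hw h
    apply cutQuotient_injOn hαβ hz hw
    rw [invPhi, invPhi, div_eq_div_iff (hne _ (hre z hz)) (hne _ (hre w hw))] at h
    rw [← cpow_half_sq (cutQuotient α β z), ← cpow_half_sq (cutQuotient α β w)]
    congr 1
    linear_combination (-1 / 2) * h
  · intro z hz
    have hq : cutQuotient α β (conj z) = conj (cutQuotient α β z) := by
      unfold cutQuotient; split_ifs <;> simp
    have hh : conj (1 / 2 : ℂ) = 1 / 2 := by
      simp [Complex.conj_ofNat]
    have : cutQuotient α β (conj z) ^ (1 / 2 : ℂ) = conj (cutQuotient α β z ^ (1 / 2 : ℂ)) := by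
      rw [hq, Complex.conj_cpow _ _
        (Complex.mem_slitPlane_iff_arg.1 (cutQuotient_mem_slitPlane hαβ hz)).1, hh]
    simp only [invPhi, this, map_div₀, map_sub, map_add, map_one]
  · ext u
    constructor
    · rintro ⟨z, hz, rfl⟩
      refine ⟨?_, ?_⟩
      · have h1 := norm_one_sub_lt (hre z hz)
        rw [invPhi, norm_div, div_lt_one (norm_pos_iff.2 (hne _ (hre z hz)))]
        exact h1
      · intro hα h
        rw [invPhi, div_eq_zero_iff, or_iff_left (hne _ (hre z hz)), sub_eq_zero] at h
        have hq := cpow_half_sq (cutQuotient α β z)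
        rw [← h, cutQuotient, if_neg hα] at hq
        have hαc : ((α.toReal : ℝ) : EReal) = α := EReal.coe_toReal hαβ.ne_top hα
        have hz0 := hcutne α.toReal hαc.symm z hz
        rw [one_pow, eq_div_iff hz0] at hq
        have h2 : ((α.toReal : ℝ) : ℂ) = (β : ℂ) := by linear_combination -hq
        have h3 : α.toReal = β := by exact_mod_cast h2
        rw [← hαc, h3] at hαβ
        exact lt_irrefl _ hαβ
    · rintro ⟨hu, hu0⟩
      have hu1 : 1 + u ≠ 0 := fun h => by
        have : u = -1 := by linear_combination h
        rw [this] at hu; simp at hu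
      set s : ℂ := (1 - u) / (1 + u) with hs
      have hsre : 0 < s.re := by
        have h2 : s.re = (1 - Complex.normSq u) / Complex.normSq (1 + u) := by
          rw [hs, Complex.div_re, ← add_div]
          congr 1
          simp [Complex.normSq_apply]; ring
        rw [h2]
        apply div_pos _ (Complex.normSq_pos.2 hu1)
        rw [← Complex.sq_norm]
        nlinarith [norm_nonneg u]
      have hsqrt : (s ^ 2) ^ (1 / 2 : ℂ) = s := by
        have h1 : |s.arg| < Real.pi / 2 := Complex.abs_arg_lt_pi_div_two_iff.2 (Or.inl hsre)
        rw [abs_lt] at h1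
        rw [one_div]
        exact Complex.pow_cpow_nat_inv (n := 2) (by norm_num) (by push_cast; linarith [h1.1])
          (by push_cast; linarith [h1.2])
      have hus : (1 - s) / (1 + s) = u := by
        have := hne s hsre
        rw [div_eq_iff this, hs]
        field_simp
        ring
      have hslit : ∀ t : ℝ, t ≤ 0 → s ^ 2 ≠ t := by
        intro t ht h
        have hr := congrArg Complex.re h
        have hi := congrArg Complex.im h
        simp [pow_two] at hr hi
        have : s.im = 0 := by
          have : s.re * s.im = 0 := by linarith
          exact (mul_eq_zero.1 this).resolve_left hsre.ne'
        rw [this] at hr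
        nlinarith
      suffices h : ∃ z ∉ complexCut α β, cutQuotient α β z = s ^ 2 by
        obtain ⟨z, hz, hq⟩ := h
        exact ⟨z, hz, by rw [invPhi, hq, hsqrt, hus]⟩
      induction α using EReal.rec with
      | bot =>
        refine ⟨β + s ^ 2, ?_, by simp [cutQuotient]⟩
        rintro ⟨x, ⟨-, hx⟩, h⟩
        exact hslit (x - β) (by linarith) (by push_cast; linear_combination -h)
      | top => exact absurd hαβ (by simp)
      | coe a =>
        have hab : a < β := by exact_mod_cast hαβ
        have hb : (β - a : ℂ) ≠ 0 := by
          have : (β - a : ℝ) ≠ 0 := by linarith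
          exact_mod_cast this
        have hs1 : 1 - s ^ 2 ≠ 0 := by
          intro h
          have h1 : (1 - s) * (1 + s) = 0 := by linear_combination h
          have h2 := (mul_eq_zero.1 h1).resolve_right (hne s hsre)
          rw [h2, zero_div] at hus
          exact hu0 (by simp) hus.symm
        have key : ((β - a * s ^ 2) / (1 - s ^ 2) - β) / ((β - a * s ^ 2) / (1 - s ^ 2) - a)
            = s ^ 2 := by
          have h1 : (β - a * s ^ 2) / (1 - s ^ 2) - a = (β - a) / (1 - s ^ 2) := by
            field_simp; ring
          have h2 : (β - a * s ^ 2) / (1 - s ^ 2) - β = (β - a) * s ^ 2 / (1 - s ^ 2) := by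
            field_simp; ring
          rw [h1, h2]
          field_simp
        refine ⟨(β - a * s ^ 2) / (1 - s ^ 2), ?_, by simpa [cutQuotient] using key⟩
        rintro ⟨x, ⟨hx1, hx2⟩, h⟩
        have hx1' : a ≤ x := by exact_mod_cast hx1
        simp only at h
        rw [← h] at key
        refine hslit ((x - β) / (x - a)) ?_ (by push_cast; exact key.symm)
        exact div_nonpos_of_nonpos_of_nonneg (by linarith) (by linarith)

/-!
Write `ω = ∏ (X - z_j)`. By conjugation symmetry `ω` is real and of constant sign `σ` on the cut,
so `dν = |ω|⁻¹ dμ` is a positive measure, with finite moments of order `< 2m`. Let `Q` be its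
orthogonal polynomial of degree `m` and `J(z) = ∫ Q(x) / (z - x) dν(x)`. The zeros of `Q` lie in
the cut (`root_mem_of_orthogonal`), and orthogonality gives a polynomial `P` of degree `< m` with
`Q f - P = σ ω J` (`exists_interpolant_numerator`). Hence `P / Q` is the interpolant, with error
`σ ω J / Q`; it is unique because the difference of two interpolants has `2m` zeros.

Orthogonality also gives `p(z) J(z) = ∫ Q(x) p(x) / (z - x) dν(x)` whenever `deg p ≤ m`. By the
Cauchy–Schwarz inequality `|p(z) J(z)|²` is at most
`∫ Q² / |z - x| dν · ∫ |p|² / |z - x| dν`. For `|z| ≤ 1` one has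
`Re (z - x) ≥ (-1 - β) / (1 - β) |z - x|` on the cut, so that the first integral is at most
`(1 - β) / (-1 - β) |Q(z) J(z)|` (the choice `p = Q`). If `|p|² ≤ M |ω|` on the cut, the second one
is at most `M f(-1)`. This yields (`exists_interpolant_error_le`)
`|f(z) - P(z) / Q(z)| |p(z)|² ≤ |ω(z)| M C` for `|z| ≤ 1`,
and it remains to choose `p`:

* for nodes of even multiplicity, `p = ∏ (1 - x v)` over half of the nodes. Then `|p|² = |ω|` on the
  unit circle, and the maximum principle applies;
* in general, in terms of the square root `s` one has `G = ∏ (s_j - s) / (s_j + s)`, and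
  `(1 + G)² / G` is the square of an even function of `s` divided by `∏ (s_j² - s²)`; thus it equals
  a constant times `p² / ω` with a polynomial `p` of degree at most `m`
  (`exists_blaschke_polynomial`). As `|G| = 1` on the two sides of the cut, `|(1 + G)² / G| ≤ 4`
  there, while `|G / (1 + G)²| ≤ η / (1 - η)²` on the disk.
-/

/-! ### Measures with finitely many moments and their orthogonal polynomials -/

/-- A measure carried by `K` whose moments of order `< 2m` are finite and which is not carried by
the zeros of a nonzero polynomial. Moments of order `2m` are not required: they may be infinite for
`|ω|⁻¹ dμ` when `K` is unbounded. -/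
structure IsMomentMeasure (K : Set ℝ) (m : ℕ) (ν : Measure ℝ) : Prop where
  ae_mem : ∀ᵐ x ∂ν, x ∈ K
  integrable_pow : ∀ k < 2 * m, Integrable (fun x : ℝ => x ^ k) ν
  eq_zero_of_ae : ∀ p : ℂ[X], (∀ᵐ x : ℝ ∂ν, p.eval (x : ℂ) = 0) → p = 0

theorem integrable_eval {K : Set ℝ} {m : ℕ} {ν : Measure ℝ} (hν : IsMomentMeasure K m ν)
    {p : ℂ[X]} (hp : p.natDegree < 2 * m) : Integrable (fun x : ℝ => p.eval (x : ℂ)) ν := by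
  simp only [eval_eq_sum_range]
  refine integrable_finsetSum _ fun k hk => Integrable.const_mul ?_ _
  have := (hν.integrable_pow k (by have := Finset.mem_range.1 hk; omega)).ofReal (𝕜 := ℂ)
  simpa using this

theorem eval_map_conj_ofReal (p : ℂ[X]) (x : ℝ) :
    (p.map (starRingEnd ℂ)).eval (x : ℂ) = conj (p.eval (x : ℂ)) := by
  rw [eval_map, ← eval₂_at_apply, Complex.conj_ofReal]

theorem integral_normSq_eval_pos {K : Set ℝ} {m : ℕ} {ν : Measure ℝ} (hν : IsMomentMeasure K m ν)
    {p : ℂ[X]} (hp : p.natDegree < m) (hp0 : p ≠ 0) :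
    Integrable (fun x : ℝ => ‖p.eval (x : ℂ)‖ ^ 2) ν ∧
      0 < ∫ x : ℝ, ‖p.eval (x : ℂ)‖ ^ 2 ∂ν := by
  have hint : Integrable (fun x : ℝ => ‖p.eval (x : ℂ)‖ ^ 2) ν := by
    have h := (integrable_eval hν (p := p * p) (by
      have := natDegree_mul_le (p := p) (q := p); omega)).norm
    simpa [pow_two] using h
  refine ⟨hint, lt_of_le_of_ne (integral_nonneg fun x => by positivity) fun h => hp0 ?_⟩
  have h0 := (integral_eq_zero_iff_of_nonneg (fun x => by positivity) hint).1 h.symm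
  refine hν.eq_zero_of_ae p ?_
  filter_upwards [h0] with x hx
  simpa using hx

/-- The `m`-th orthogonal polynomial. It has degree exactly `m`, since a polynomial of smaller
degree is not orthogonal to its own conjugate. -/
theorem exists_orthogonal_polynomial {K : Set ℝ} {m : ℕ} {ν : Measure ℝ}
    (hν : IsMomentMeasure K m ν) : ∃ Q : ℝ[X], Q.natDegree = m ∧ Q ≠ 0 ∧
      ∀ s : ℂ[X], s.natDegree < m →
        ∫ x : ℝ, (Q.map Complex.ofRealHom).eval (x : ℂ) * s.eval (x : ℂ) ∂ν = 0 := by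
  -- `m` homogeneous equations in the `m + 1` coefficients of `Q`
  let c : ℕ → ℝ := fun k => ∫ x : ℝ, x ^ k ∂ν
  let T : (Fin (m + 1) → ℝ) →ₗ[ℝ] (Fin m → ℝ) :=
    Matrix.toLin' (Matrix.of fun (k : Fin m) (i : Fin (m + 1)) => c (i + k))
  obtain ⟨a, ha, ha0⟩ := (Submodule.ne_bot_iff _).1
    (LinearMap.ker_ne_bot_of_finrank_lt (f := T) (by simp))
  let Q : ℝ[X] := ∑ i : Fin (m + 1), monomial (i : ℕ) (a i)
  have hcoeff : ∀ i : Fin (m + 1), Q.coeff i = a i := by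
    intro i
    simp [Q, coeff_monomial, Fin.val_inj]
  have hQ0 : Q ≠ 0 := by
    intro h
    apply ha0
    ext i
    rw [← hcoeff i, h]; simp
  have hdeg : Q.natDegree ≤ m := by
    refine natDegree_sum_le_of_forall_le _ _ fun i _ => (natDegree_monomial_le _).trans ?_
    have := i.2; omega
  have hev : ∀ x : ℝ, (Q.map Complex.ofRealHom).eval (x : ℂ)
      = ∑ i : Fin (m + 1), (a i : ℂ) * (x : ℂ) ^ (i : ℕ) := by
    intro x
    simp [Q, Polynomial.map_sum, eval_finsetSum, map_monomial, eval_monomial]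
  have hpow : ∀ k < m, ∫ x : ℝ, (Q.map Complex.ofRealHom).eval (x : ℂ) * (x : ℂ) ^ k ∂ν = 0 := by
    intro k hk
    have h1 : T a ⟨k, hk⟩ = 0 := by rw [LinearMap.mem_ker.1 ha]; rfl
    have h2 : ∀ x : ℝ, (Q.map Complex.ofRealHom).eval (x : ℂ) * (x : ℂ) ^ k
        = ((∑ i : Fin (m + 1), a i * x ^ ((i : ℕ) + k) : ℝ) : ℂ) := by
      intro x
      rw [hev, Finset.sum_mul]
      push_cast
      exact Finset.sum_congr rfl fun i _ => by ring
    simp_rw [h2]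
    rw [integral_complex_ofReal, integral_finsetSum]
    · simp only [integral_const_mul]
      rw [Matrix.toLin'_apply] at h1
      simp only [Matrix.mulVec, dotProduct, Matrix.of_apply, c] at h1
      simp_rw [mul_comm (a _)]
      rw [h1]; simp
    · intro i _
      exact (hν.integrable_pow _ (by have := i.2; omega)).const_mul _
  have horth : ∀ s : ℂ[X], s.natDegree < m →
      ∫ x : ℝ, (Q.map Complex.ofRealHom).eval (x : ℂ) * s.eval (x : ℂ) ∂ν = 0 := by
    intro s hs
    simp only [eval_eq_sum_range (p := s), Finset.mul_sum]
    rw [integral_finsetSum]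
    · refine Finset.sum_eq_zero fun k hk => ?_
      have hk' := Finset.mem_range.1 hk
      simp_rw [mul_left_comm _ (s.coeff k)]
      rw [integral_const_mul, hpow k (by omega), mul_zero]
    · intro k hk
      have hk' := Finset.mem_range.1 hk
      have := integrable_eval hν (p := Q.map Complex.ofRealHom * (C (s.coeff k) * X ^ k)) (by
        refine natDegree_mul_le.trans_lt ?_
        have h1 := natDegree_map_le (f := Complex.ofRealHom) (p := Q)
        have h2 := natDegree_C_mul_X_pow_le (s.coeff k) k
        omega)
      simpa using this
  refine ⟨Q, hdeg.antisymm ?_, hQ0, horth⟩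
  by_contra hlt
  push Not at hlt
  have hmap0 : Q.map Complex.ofRealHom ≠ 0 :=
    (Polynomial.map_ne_zero_iff Complex.ofRealHom.injective).2 hQ0
  have hmapd : (Q.map Complex.ofRealHom).natDegree < m := natDegree_map_le.trans_lt hlt
  have h1 := (integral_normSq_eval_pos hν hmapd hmap0).2
  have h2 := horth ((Q.map Complex.ofRealHom).map (starRingEnd ℂ)) (natDegree_map_le.trans_lt hmapd)
  simp_rw [eval_map_conj_ofReal, Complex.mul_conj, Complex.normSq_eq_norm_sq] at h2
  rw [integral_complex_ofReal] at h2
  exact h1.ne' (by exact_mod_cast h2)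

/-- The zeros of an orthogonal polynomial lie in every interval that carries the measure: if
`Q = (X - w) p`, then `w` is the mean of `x` with respect to the density `|p|²`. -/
theorem root_mem_of_orthogonal {K : Set ℝ} {m : ℕ} {ν : Measure ℝ} (hν : IsMomentMeasure K m ν)
    (hK : K.OrdConnected) {Q : ℂ[X]} (hdeg : Q.natDegree ≤ m) (hQ0 : Q ≠ 0)
    (horth : ∀ s : ℂ[X], s.natDegree < m →
      ∫ x : ℝ, Q.eval (x : ℂ) * s.eval (x : ℂ) ∂ν = 0)
    {w : ℂ} (hw : Q.IsRoot w) : ∃ x ∈ K, (x : ℂ) = w := by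
  obtain ⟨p, rfl⟩ := dvd_iff_isRoot.2 hw
  have hp0 : p ≠ 0 := right_ne_zero_of_mul hQ0
  have hpd : p.natDegree < m := by
    rw [natDegree_mul (X_sub_C_ne_zero w) hp0, natDegree_X_sub_C] at hdeg
    omega
  obtain ⟨hi, hpos⟩ := integral_normSq_eval_pos hν hpd hp0
  have h1 := horth (p.map (starRingEnd ℂ)) (natDegree_map_le.trans_lt hpd)
  have hint : Integrable (fun x : ℝ =>
      ((X - C w) * p).eval (x : ℂ) * (p.map (starRingEnd ℂ)).eval (x : ℂ)) ν := by
    have := integrable_eval hν (p := (X - C w) * p * p.map (starRingEnd ℂ)) (by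
      refine natDegree_mul_le.trans_lt ?_
      have h2 := natDegree_map_le (f := starRingEnd ℂ) (p := p)
      omega)
    simpa only [eval_mul] using this
  have hfun : ∀ x : ℝ, ((X - C w) * p).eval (x : ℂ) * (p.map (starRingEnd ℂ)).eval (x : ℂ)
      = ((x : ℂ) - w) * ((‖p.eval (x : ℂ)‖ ^ 2 : ℝ) : ℂ) := by
    intro x
    rw [eval_map_conj_ofReal, eval_mul, mul_assoc, Complex.mul_conj, Complex.normSq_eq_norm_sq]
    simp
  simp_rw [hfun] at h1 hint
  have him := congrArg Complex.im h1
  have hre := congrArg Complex.re h1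
  rw [← RCLike.im_eq_complex_im, ← integral_im hint] at him
  rw [← RCLike.re_eq_complex_re, ← integral_re hint] at hre
  simp only [RCLike.im_eq_complex_im, RCLike.re_eq_complex_re, Complex.im_mul_ofReal,
    Complex.re_mul_ofReal, Complex.sub_im, Complex.sub_re, Complex.ofReal_im, Complex.ofReal_re,
    Complex.zero_im, Complex.zero_re] at him hre
  have hint_re := hint.re
  simp only [RCLike.re_eq_complex_re, Complex.re_mul_ofReal, Complex.sub_re,
    Complex.ofReal_re] at hint_re
  rw [integral_const_mul] at him
  have hwim : w.im = 0 := by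
    rcases mul_eq_zero.1 him with h | h
    · linarith
    · exact absurd h hpos.ne'
  refine ⟨w.re, ?_, Complex.ext (by simp) (by simp [hwim])⟩
  by_contra hwK
  -- `x - Re w` has constant sign on `K`, so `|p|²` vanishes almost everywhere
  have key : (fun x : ℝ => (x - w.re) * ‖p.eval (x : ℂ)‖ ^ 2) =ᵐ[ν] 0 := by
    by_cases h : ∃ y ∈ K, y < w.re
    · obtain ⟨y, hy, hyw⟩ := h
      have hle : ∀ x ∈ K, x < w.re := fun x hx => by
        by_contra hxw
        exact hwK (hK.out hy hx ⟨hyw.le, not_lt.1 hxw⟩)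
      have h2 := (integral_eq_zero_iff_of_nonneg_ae (f := fun x : ℝ =>
        -((x - w.re) * ‖p.eval (x : ℂ)‖ ^ 2)) ?_ hint_re.neg).1 (by
          rw [integral_neg, hre, neg_zero])
      · filter_upwards [h2] with x hx
        simpa using hx
      · filter_upwards [hν.ae_mem] with x hx
        have := hle x hx
        simp only [Pi.zero_apply]
        nlinarith [sq_nonneg ‖p.eval (x : ℂ)‖]
    · push Not at h
      refine (integral_eq_zero_iff_of_nonneg_ae ?_ hint_re).1 hre
      filter_upwards [hν.ae_mem] with x hx
      have := h x hx
      exact mul_nonneg (by linarith) (by positivity)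
  refine hp0 (hν.eq_zero_of_ae p ?_)
  filter_upwards [key, hν.ae_mem] with x hx hxK
  rcases mul_eq_zero.1 hx with h | h
  · exact absurd hxK (by rwa [show x = w.re by linarith])
  · simpa using h

/-! ### Cauchy transforms of polynomial densities -/

/-- The Cauchy transform `z ↦ ∫ p(x) / (z - x) dν(x)` of the density `p` with respect to `ν`. -/
noncomputable def cauchyTransform (ν : Measure ℝ) (p : ℂ[X]) (z : ℂ) : ℂ :=
  ∫ x : ℝ, p.eval (x : ℂ) / (z - (x : ℂ)) ∂ν

theorem exists_le_norm_sub {K : Set ℝ} (hK : IsClosed K) {z : ℂ}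
    (hz : z ∉ (fun x : ℝ => (x : ℂ)) '' K) :
    ∃ d > 0, ∀ w ∈ Metric.ball z d, ∀ x ∈ K, d ≤ ‖w - (x : ℂ)‖ := by
  have hcl : IsClosed ((fun x : ℝ => (x : ℂ)) '' K) :=
    Complex.isometry_ofReal.isClosedEmbedding.isClosedMap K hK
  obtain ⟨d, hd, hball⟩ := Metric.isOpen_iff.1 hcl.isOpen_compl z hz
  refine ⟨d / 2, by positivity, fun w hw x hx => ?_⟩
  by_contra h
  push Not at h
  refine hball (?_ : (x : ℂ) ∈ Metric.ball z d) ⟨x, hx, rfl⟩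
  rw [Metric.mem_ball, dist_eq_norm] at hw ⊢
  calc ‖(x : ℂ) - z‖ = ‖(w - z) - (w - x)‖ := by congr 1; ring
    _ ≤ ‖w - z‖ + ‖w - x‖ := norm_sub_le _ _
    _ < d := by linarith

theorem sub_ofReal_ne_zero {K : Set ℝ} {z : ℂ} (hz : z ∉ (fun x : ℝ => (x : ℂ)) '' K) {x : ℝ}
    (hx : x ∈ K) : z - (x : ℂ) ≠ 0 :=
  fun h => hz ⟨x, hx, (sub_eq_zero.1 h).symm⟩

section

variable {K : Set ℝ} {m : ℕ} {ν : Measure ℝ}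

/-- Division by `z - x` gains one order: densities of degree `2m` are admissible although the
moment of order `2m` may be infinite. -/
theorem integrable_eval_div (hν : IsMomentMeasure K m ν) (hm : 1 ≤ m) (hK : IsClosed K) {z : ℂ}
    (hz : z ∉ (fun x : ℝ => (x : ℂ)) '' K) {p : ℂ[X]} (hp : p.natDegree ≤ 2 * m) :
    Integrable (fun x : ℝ => p.eval (x : ℂ) / (z - (x : ℂ))) ν := by
  obtain ⟨d, hd, hdist⟩ := exists_le_norm_sub hK hz
  have h1 : Integrable (fun _ : ℝ => (1 : ℂ)) ν := by
    simpa using integrable_eval hν (p := 1) (by simp; omega)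
  have h2 : Integrable (fun x : ℝ => 1 / (z - (x : ℂ))) ν := by
    refine Integrable.mono' (g := fun _ => d⁻¹) ?_ ?_ ?_
    · have := (h1.norm.const_mul d⁻¹)
      simpa using this
    · exact (by fun_prop : Measurable fun x : ℝ => 1 / (z - (x : ℂ))).aestronglyMeasurable
    · filter_upwards [hν.ae_mem] with x hx
      rw [norm_div, norm_one, one_div]
      exact inv_anti₀ hd (hdist z (Metric.mem_ball_self hd) x hx)
  have h3 : Integrable (fun x : ℝ => (p /ₘ (X - C z)).eval (x : ℂ)) ν := by
    apply integrable_eval hν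
    rw [natDegree_divByMonic _ (monic_X_sub_C z), natDegree_X_sub_C]
    omega
  refine ((h2.const_mul (p.eval z)).sub h3).congr ?_
  filter_upwards [hν.ae_mem] with x hx
  have hne := sub_ofReal_ne_zero hz hx
  have h4 := congrArg (eval (x : ℂ)) (X_sub_C_mul_divByMonic_eq_sub_modByMonic p z)
  rw [modByMonic_X_sub_C_eq_C_eval] at h4
  simp only [eval_mul, eval_sub, eval_X, eval_C] at h4
  simp only [Pi.sub_apply]
  field_simp
  linear_combination h4

/-- An orthogonal polynomial reproduces polynomial factors of degree at most `m` under the Cauchy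
transform, because `(p(z) - p(x)) / (z - x)` has degree `< m` in `x`. -/
theorem eval_mul_cauchyTransform (hν : IsMomentMeasure K m ν) (hm : 1 ≤ m) (hK : IsClosed K)
    {z : ℂ} (hz : z ∉ (fun x : ℝ => (x : ℂ)) '' K) {Q p : ℂ[X]} (hQ : Q.natDegree ≤ m)
    (horth : ∀ s : ℂ[X], s.natDegree < m →
      ∫ x : ℝ, Q.eval (x : ℂ) * s.eval (x : ℂ) ∂ν = 0) (hp : p.natDegree ≤ m) :
    p.eval z * cauchyTransform ν Q z = cauchyTransform ν (Q * p) z := by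
  have hs : (p /ₘ (X - C z)).natDegree < m := by
    rw [natDegree_divByMonic _ (monic_X_sub_C z), natDegree_X_sub_C]
    omega
  have h0 := horth _ hs
  rw [cauchyTransform, cauchyTransform, ← integral_const_mul, ← sub_eq_zero, ← integral_sub, ← h0]
  · refine integral_congr_ae ?_
    filter_upwards [hν.ae_mem] with x hx
    have hne := sub_ofReal_ne_zero hz hx
    have h4 := congrArg (eval (x : ℂ)) (X_sub_C_mul_divByMonic_eq_sub_modByMonic p z)
    rw [modByMonic_X_sub_C_eq_C_eval] at h4
    simp only [eval_mul, eval_sub, eval_X, eval_C] at h4 ⊢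
    rw [← mul_div_assoc, ← sub_div, div_eq_iff hne]
    linear_combination Q.eval (x : ℂ) * h4
  · exact (integrable_eval_div hν hm hK hz (by omega)).const_mul _
  · exact integrable_eval_div hν hm hK hz (natDegree_mul_le.trans (by omega))

/-- `∫ (A(z) - A(x)) / (z - x) R(x) dν(x)` is a polynomial in `z` of degree `< deg A`. -/
theorem exists_polynomial_cauchyTransform (hν : IsMomentMeasure K m ν) (hm : 1 ≤ m)
    (hK : IsClosed K) {A R : ℂ[X]} (hAR : A.natDegree + R.natDegree ≤ 2 * m) :
    ∃ P : ℂ[X], P.natDegree ≤ A.natDegree - 1 ∧ ∀ z ∉ (fun x : ℝ => (x : ℂ)) '' K,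
      A.eval z * cauchyTransform ν R z - cauchyTransform ν (A * R) z = P.eval z := by
  refine ⟨∑ n ∈ Finset.range (A.natDegree + 1), ∑ i ∈ Finset.range n,
    C (A.coeff n * ∫ x : ℝ, (x : ℂ) ^ (n - 1 - i) * R.eval (x : ℂ) ∂ν) * X ^ i, ?_, ?_⟩
  · refine natDegree_sum_le_of_forall_le _ _ fun n hn =>
      natDegree_sum_le_of_forall_le _ _ fun i hi => (natDegree_C_mul_X_pow_le _ _).trans ?_
    have := Finset.mem_range.1 hn
    have := Finset.mem_range.1 hi
    omega
  · intro z hz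
    have hint : ∀ n ∈ Finset.range (A.natDegree + 1), ∀ i ∈ Finset.range n,
        Integrable (fun x : ℝ => A.coeff n * z ^ i * ((x : ℂ) ^ (n - 1 - i) * R.eval (x : ℂ))) ν := by
      intro n hn i hi
      have := Finset.mem_range.1 hn
      have := Finset.mem_range.1 hi
      have h := integrable_eval hν (p := X ^ (n - 1 - i) * R) (by
        refine natDegree_mul_le.trans_lt ?_
        rw [natDegree_X_pow]; omega)
      simp only [eval_mul, eval_pow, eval_X] at h
      exact h.const_mul _
    rw [cauchyTransform, cauchyTransform, ← integral_const_mul, ← integral_sub]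
    · have hpt : ∀ᵐ x : ℝ ∂ν, A.eval z * (R.eval (x : ℂ) / (z - x))
          - (A * R).eval (x : ℂ) / (z - x)
          = ∑ n ∈ Finset.range (A.natDegree + 1), ∑ i ∈ Finset.range n,
            A.coeff n * z ^ i * ((x : ℂ) ^ (n - 1 - i) * R.eval (x : ℂ)) := by
        filter_upwards [hν.ae_mem] with x hx
        have hne := sub_ofReal_ne_zero hz hx
        rw [← mul_div_assoc, ← sub_div, div_eq_iff hne, eval_mul, ← sub_mul,
          eval_eq_sum_range (p := A) z, eval_eq_sum_range (p := A) (x : ℂ),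
          ← Finset.sum_sub_distrib, Finset.sum_mul, Finset.sum_mul]
        refine Finset.sum_congr rfl fun n _ => ?_
        rw [← mul_sub, ← (Commute.all z (x : ℂ)).geom_sum₂_mul n, Finset.sum_mul, Finset.mul_sum,
          Finset.sum_mul, Finset.sum_mul]
        exact Finset.sum_congr rfl fun i _ => by ring
      rw [integral_congr_ae hpt, integral_finsetSum _ fun n hn => integrable_finsetSum _ (hint n hn),
        eval_finsetSum]
      refine Finset.sum_congr rfl fun n hn => ?_
      rw [integral_finsetSum _ (hint n hn), eval_finsetSum]
      refine Finset.sum_congr rfl fun i _ => ?_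
      rw [integral_const_mul]
      simp only [eval_mul, eval_C, eval_pow, eval_X]
      ring
    · exact (integrable_eval_div hν hm hK hz (by omega)).const_mul _
    · exact integrable_eval_div hν hm hK hz (natDegree_mul_le.trans hAR)

/-- The numerator of the rational interpolant: modulo a polynomial of degree `< m`, multiplication
by the orthogonal polynomial `Q` turns the Cauchy transform of `ω` into `ω` times that of `Q`. -/
theorem exists_interpolant_numerator (hν : IsMomentMeasure K m ν) (hm : 1 ≤ m)
    (hK : IsClosed K) {Q ω : ℂ[X]} (hQ : Q.natDegree = m) (hω : ω.natDegree ≤ 2 * m)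
    (horth : ∀ s : ℂ[X], s.natDegree < m →
      ∫ x : ℝ, Q.eval (x : ℂ) * s.eval (x : ℂ) ∂ν = 0) :
    ∃ P : ℂ[X], P.natDegree ≤ m - 1 ∧ ∀ z ∉ (fun x : ℝ => (x : ℂ)) '' K,
      Q.eval z * cauchyTransform ν ω z = P.eval z + ω.eval z * cauchyTransform ν Q z := by
  have hQ0 : Q.natDegree ≠ 0 := by omega
  have hR := natDegree_mod_lt ω hQ0
  have hdec : Q * (ω / Q) + ω % Q = ω := EuclideanDomain.div_add_mod ω Q
  have hS : (ω / Q).natDegree ≤ m := by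
    rcases eq_or_ne (ω / Q) 0 with h0 | h0
    · simp [h0]
    · have h1 := natDegree_mul (ne_zero_of_natDegree_gt (Nat.pos_of_ne_zero hQ0)) h0
      have h2 : (Q * (ω / Q)).natDegree ≤ 2 * m := by
        rw [show Q * (ω / Q) = ω - ω % Q from eq_sub_of_add_eq hdec]
        exact (natDegree_sub_le _ _).trans (by omega)
      omega
  obtain ⟨P, hP, hPz⟩ := exists_polynomial_cauchyTransform hν hm hK (A := Q) (R := ω % Q)
    (by omega)
  refine ⟨P, by omega, fun z hz => ?_⟩
  have h1 := eval_mul_cauchyTransform hν hm hK hz hQ.le horth hS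
  have h2 := eval_mul_cauchyTransform hν hm hK hz hQ.le horth (p := ω % Q) (by omega)
  have h3 : cauchyTransform ν ω z
      = cauchyTransform ν (Q * (ω / Q)) z + cauchyTransform ν (ω % Q) z := by
    rw [cauchyTransform, cauchyTransform, cauchyTransform, ← integral_add]
    · congr 1
      funext x
      rw [← add_div, ← eval_add, hdec]
    · exact integrable_eval_div hν hm hK hz (natDegree_mul_le.trans (by omega))
    · exact integrable_eval_div hν hm hK hz (by omega)
  have h4 : ω.eval z = Q.eval z * (ω / Q).eval z + (ω % Q).eval z := by
    rw [← eval_mul, ← eval_add, hdec]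
  rw [h3, h4, ← hPz z hz]
  linear_combination (-Q.eval z) * h1 - h2

theorem differentiableOn_cauchyTransform (hν : IsMomentMeasure K m ν) (hm : 1 ≤ m)
    (hK : IsClosed K) {p : ℂ[X]} (hp : p.natDegree < 2 * m) :
    DifferentiableOn ℂ (cauchyTransform ν p) ((fun x : ℝ => (x : ℂ)) '' K)ᶜ := by
  intro z hz
  obtain ⟨d, hd, hdist⟩ := exists_le_norm_sub hK hz
  refine DifferentiableAt.differentiableWithinAt ?_
  refine (hasDerivAt_integral_of_dominated_loc_of_deriv_le (μ := ν)
    (F := fun w x => p.eval (x : ℂ) / (w - (x : ℂ)))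
    (F' := fun w x => -p.eval (x : ℂ) / (w - (x : ℂ)) ^ 2)
    (bound := fun x => ‖p.eval (x : ℂ)‖ * (d ^ 2)⁻¹)
    (Metric.ball_mem_nhds z hd) ?_ ?_ ?_ ?_ ?_ ?_).2.differentiableAt
  · refine Filter.Eventually.of_forall fun w => ?_
    exact (by fun_prop : Measurable fun x : ℝ =>
      p.eval (x : ℂ) / (w - (x : ℂ))).aestronglyMeasurable
  · exact integrable_eval_div hν hm hK hz hp.le
  · exact (by fun_prop : Measurable fun x : ℝ =>
      -p.eval (x : ℂ) / (z - (x : ℂ)) ^ 2).aestronglyMeasurable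
  · filter_upwards [hν.ae_mem] with x hx w hw
    rw [norm_div, norm_neg, norm_pow, div_eq_mul_inv]
    have := hdist w hw x hx
    gcongr
  · exact (integrable_eval hν hp).norm.mul_const _
  · filter_upwards [hν.ae_mem] with x hx w hw
    have hne : w - (x : ℂ) ≠ 0 := norm_pos_iff.1 (hd.trans_le (hdist w hw x hx))
    have := ((hasDerivAt_const w (p.eval (x : ℂ))).fun_div
      ((hasDerivAt_id' w).sub_const (x : ℂ)) hne)
    simpa using this

/-- The extremal property of the orthogonal polynomial. The Cauchy–Schwarz inequality bounds
`p(z) J(z) = ∫ Q p / (z - x) dν`, where `J` is the Cauchy transform of `Q`, and `∫ Q² / |z - x| dν`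
is in turn bounded by a multiple of `|Q(z) J(z)|`, since for `|z| ≤ 1` the numbers `z - x` lie in
a proper sector of the right half plane. -/
theorem norm_cauchyTransform_le (hν : IsMomentMeasure K m ν) (hm : 1 ≤ m)
    (hK : IsClosed K) {β : ℝ} (hβ : β < -1) (hKβ : ∀ x ∈ K, x ≤ β) {Q : ℝ[X]}
    (hQ : Q.natDegree ≤ m) (horth : ∀ s : ℂ[X], s.natDegree < m →
      ∫ x : ℝ, (Q.map Complex.ofRealHom).eval (x : ℂ) * s.eval (x : ℂ) ∂ν = 0)
    {p : ℂ[X]} (hp : p.natDegree ≤ m) {z : ℂ} (hz : ‖z‖ ≤ 1) :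
    ‖p.eval z‖ ^ 2 * ‖cauchyTransform ν (Q.map Complex.ofRealHom) z‖ ≤
      (1 - β) / (-1 - β) * ‖(Q.map Complex.ofRealHom).eval z‖ *
        ∫ x : ℝ, ‖p.eval (x : ℂ)‖ ^ 2 / (-1 - x) ∂ν := by
  set q := Q.map Complex.ofRealHom with hq
  have hqd : q.natDegree ≤ m := natDegree_map_le.trans hQ
  have hzre : -1 ≤ z.re := by
    have := (abs_le.1 (Complex.abs_re_le_norm z)).1; linarith
  have hout : ∀ w : ℂ, -1 ≤ w.re → w ∉ (fun x : ℝ => (x : ℂ)) '' K := by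
    rintro w hw ⟨x, hx, rfl⟩
    have := hKβ x hx
    simp at hw; linarith
  have hzK := hout z hzre
  have h1K := hout (-1) (by simp)
  -- the three quadratic integrals
  have hI : ∀ a b : ℂ[X], a.natDegree ≤ m → b.natDegree ≤ m → Integrable (fun x : ℝ =>
      ‖a.eval (x : ℂ)‖ * ‖b.eval (x : ℂ)‖ / ‖z - x‖) ν := by
    intro a b ha hb
    have := (integrable_eval_div hν hm hK hzK (p := a * b)
      (natDegree_mul_le.trans (by omega))).norm
    simpa only [eval_mul, norm_mul, norm_div] using this
  have hX := hI q q hqd hqd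
  have hY := hI p q hp hqd
  have hZ := hI p p hp hp
  set X₀ := ∫ x : ℝ, ‖q.eval (x : ℂ)‖ * ‖q.eval (x : ℂ)‖ / ‖z - x‖ ∂ν
  set Y₀ := ∫ x : ℝ, ‖p.eval (x : ℂ)‖ * ‖q.eval (x : ℂ)‖ / ‖z - x‖ ∂ν
  set Z₀ := ∫ x : ℝ, ‖p.eval (x : ℂ)‖ * ‖p.eval (x : ℂ)‖ / ‖z - x‖ ∂ν
  have hCS : Y₀ ^ 2 ≤ X₀ * Z₀ := by
    have hquad : ∀ t : ℝ, 0 ≤ X₀ * (t * t) + (-2 * Y₀) * t + Z₀ := by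
      intro t
      have h : X₀ * (t * t) + (-2 * Y₀) * t + Z₀ =
          ∫ x : ℝ, (‖q.eval (x : ℂ)‖ * t - ‖p.eval (x : ℂ)‖) ^ 2 / ‖z - x‖ ∂ν := by
        rw [← integral_mul_const, ← integral_const_mul, ← integral_mul_const,
          ← integral_add, ← integral_add]
        · congr 1
          funext x
          ring
        · exact (hX.mul_const _).add ((hY.const_mul _).mul_const _)
        · exact hZ
        · exact hX.mul_const _
        · exact (hY.const_mul _).mul_const _
      rw [h]
      exact integral_nonneg fun x => by positivity
    have := discrim_le_zero hquad
    rw [discrim] at this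
    nlinarith
  have hpJ : ‖p.eval z‖ * ‖cauchyTransform ν q z‖ ≤ Y₀ := by
    rw [← norm_mul, eval_mul_cauchyTransform hν hm hK hzK hqd horth hp, cauchyTransform]
    refine (norm_integral_le_integral_norm _).trans_eq ?_
    congr 1
    funext x
    rw [norm_div, eval_mul, norm_mul, mul_comm ‖q.eval (x : ℂ)‖]
  have hqJ : (-1 - β) / (1 - β) * X₀ ≤ ‖q.eval z‖ * ‖cauchyTransform ν q z‖ := by
    rw [← norm_mul, eval_mul_cauchyTransform hν hm hK hzK hqd horth hqd, cauchyTransform]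
    have hint := integrable_eval_div hν hm hK hzK (p := q * q)
      (natDegree_mul_le.trans (by omega))
    refine le_trans ?_ (Complex.re_le_norm _)
    rw [← RCLike.re_eq_complex_re, ← integral_re hint, ← integral_const_mul]
    refine integral_mono_ae (hX.const_mul _) hint.re ?_
    filter_upwards [hν.ae_mem] with x hx
    have hxβ := hKβ x hx
    have hne := sub_ofReal_ne_zero hzK hx
    have hpos : 0 < ‖z - x‖ := norm_pos_iff.2 hne
    have hqx : (q * q).eval (x : ℂ) = ((‖q.eval (x : ℂ)‖ ^ 2 : ℝ) : ℂ) := by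
      have : q.eval (x : ℂ) = ((Q.eval x : ℝ) : ℂ) := by
        rw [hq, eval_map, ← Complex.ofRealHom_eq_coe, eval₂_at_apply]; simp
      rw [eval_mul, this, Complex.norm_real, Real.norm_eq_abs, sq_abs]
      push_cast; ring
    have hre : ((q * q).eval (x : ℂ) / (z - x)).re
        = ‖q.eval (x : ℂ)‖ ^ 2 * (z.re - x) / ‖z - x‖ ^ 2 := by
      rw [hqx, div_eq_mul_inv, Complex.re_ofReal_mul, Complex.inv_re, Complex.normSq_eq_norm_sq]
      simp [mul_div_assoc]
    have h1 : ‖z - x‖ ≤ 1 - x := by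
      refine (norm_sub_le _ _).trans ?_
      rw [Complex.norm_real, Real.norm_eq_abs, abs_of_neg (by linarith)]
      linarith
    have h2 : (-1 - β) / (1 - β) * ‖z - x‖ ≤ z.re - x := by
      rw [div_mul_eq_mul_div, div_le_iff₀ (by linarith)]
      nlinarith [mul_le_mul_of_nonneg_left h1 (by linarith : 0 ≤ -1 - β)]
    rw [RCLike.re_eq_complex_re, hre, ← pow_two, ← mul_div_assoc,
      div_le_div_iff₀ hpos (by positivity)]
    have h3 : 0 ≤ ‖q.eval (x : ℂ)‖ ^ 2 * ‖z - x‖ := by positivity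
    nlinarith [mul_le_mul_of_nonneg_left h2 h3]
  have hint1 : Integrable (fun x : ℝ => ‖p.eval (x : ℂ)‖ ^ 2 / (-1 - x)) ν := by
    have := (integrable_eval_div hν hm hK h1K (p := p * p)
      (natDegree_mul_le.trans (by omega))).norm
    refine this.congr ?_
    filter_upwards [hν.ae_mem] with x hx
    have : 0 < -1 - x := by linarith [hKβ x hx]
    rw [norm_div, eval_mul, norm_mul, ← pow_two]
    congr 1
    rw [show (-1 - (x : ℂ)) = ((-1 - x : ℝ) : ℂ) by push_cast; ring, Complex.norm_real,
      Real.norm_of_nonneg this.le]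
  have hZB : Z₀ ≤ ∫ x : ℝ, ‖p.eval (x : ℂ)‖ ^ 2 / (-1 - x) ∂ν := by
    refine integral_mono_ae hZ hint1 ?_
    filter_upwards [hν.ae_mem] with x hx
    have hxβ := hKβ x hx
    rw [← pow_two]
    have : -1 - x ≤ ‖z - x‖ := by
      refine le_trans ?_ (Complex.re_le_norm _)
      simp; linarith
    exact div_le_div_of_nonneg_left (by positivity) (by linarith) this
  set B₀ := ∫ x : ℝ, ‖p.eval (x : ℂ)‖ ^ 2 / (-1 - x) ∂ν
  have hZ0 : 0 ≤ Z₀ := integral_nonneg fun x => by positivity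
  have hβ1 : 0 < -1 - β := by linarith
  have hβ2 : 0 < 1 - β := by linarith
  rcases (norm_nonneg (cauchyTransform ν q z)).eq_or_lt with h0 | h0
  · rw [← h0, mul_zero]
    exact mul_nonneg (mul_nonneg (div_nonneg hβ2.le hβ1.le) (norm_nonneg _)) (hZ0.trans hZB)
  · refine le_of_mul_le_mul_right ?_ h0
    have hX' : X₀ ≤ (1 - β) / (-1 - β) * (‖q.eval z‖ * ‖cauchyTransform ν q z‖) := by
      rw [div_mul_eq_mul_div, le_div_iff₀ hβ1]
      rw [div_mul_eq_mul_div, div_le_iff₀ hβ2] at hqJ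
      linarith
    calc ‖p.eval z‖ ^ 2 * ‖cauchyTransform ν q z‖ * ‖cauchyTransform ν q z‖
        = (‖p.eval z‖ * ‖cauchyTransform ν q z‖) ^ 2 := by ring
      _ ≤ Y₀ ^ 2 := by gcongr
      _ ≤ X₀ * Z₀ := hCS
      _ ≤ ((1 - β) / (-1 - β) * (‖q.eval z‖ * ‖cauchyTransform ν q z‖)) * B₀ := by gcongr
      _ = _ := by ring

end

/-! ### Interpolation nodes and the weighted measure -/

theorem realCut_eq_preimage (α : EReal) (β : ℝ) :
    realCut α β = (fun x : ℝ => (x : EReal)) ⁻¹' Set.Ici α ∩ Set.Iic β := rfl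

theorem isClosed_realCut (α : EReal) (β : ℝ) : IsClosed (realCut α β) := by
  rw [realCut_eq_preimage]
  exact (isClosed_Ici.preimage continuous_coe_real_ereal).inter isClosed_Iic

theorem ordConnected_realCut (α : EReal) (β : ℝ) : (realCut α β).OrdConnected :=
  ⟨fun _ hx _ hy _ hw => ⟨hx.1.trans (EReal.coe_le_coe_iff.2 hw.1), hw.2.trans hy.2⟩⟩

theorem isOpen_compl_complexCut (α : EReal) (β : ℝ) : IsOpen (complexCut α β)ᶜ :=
  (Complex.isometry_ofReal.isClosedEmbedding.isClosedMap _
    (isClosed_realCut α β)).isOpen_compl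

theorem notMem_complexCut_of_norm_le {α : EReal} {β : ℝ} (hβ : β < -1) {w : ℂ} (hw : ‖w‖ ≤ 1) :
    w ∉ complexCut α β := by
  rintro ⟨x, ⟨-, hx⟩, rfl⟩
  rw [Complex.norm_real, Real.norm_eq_abs, abs_le] at hw
  linarith [hw.1]

theorem pointMult_eq_count {n : ℕ} (z : Fin n → ℂ) (w : ℂ) :
    pointMult z w = (Finset.univ.val.map z).count w := by
  classical
  rw [pointMult, Nat.card_eq_fintype_card, Fintype.card_subtype, Multiset.count_map]
  simp [Finset.card_def, eq_comm]

/-- Products over the nodes are unchanged when all nodes are conjugated. -/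
theorem prod_comp_conj {n : ℕ} {z : Fin n → ℂ}
    (hconj : ∀ w : ℂ, pointMult z (conj w) = pointMult z w)
    {M : Type*} [CommMonoid M] (F : ℂ → M) : ∏ j, F (conj (z j)) = ∏ j, F (z j) := by
  have h : (Finset.univ.val.map z).map (starRingEnd ℂ) = Finset.univ.val.map z := by
    classical
    refine Multiset.ext.2 fun w => ?_
    rw [← pointMult_eq_count, ← hconj w, pointMult_eq_count]
    conv_lhs => rw [← Complex.conj_conj w]
    exact Multiset.count_map_eq_count' _ _ (starRingEnd ℂ).injective _
  calc ∏ j, F (conj (z j))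
      = (((Finset.univ.val.map z).map (starRingEnd ℂ)).map F).prod := by
        rw [Multiset.map_map, Multiset.map_map]; rfl
    _ = ∏ j, F (z j) := by rw [h, Multiset.map_map]; rfl

/-- The monic polynomial `ω` with zeros at the nodes. -/
noncomputable def nodePoly {n : ℕ} (z : Fin n → ℂ) : ℂ[X] := ∏ j, (X - C (z j))

theorem natDegree_nodePoly {n : ℕ} (z : Fin n → ℂ) : (nodePoly z).natDegree = n := by
  rw [nodePoly, natDegree_prod_of_monic _ _ fun j _ => monic_X_sub_C _]
  simp

theorem eval_nodePoly {n : ℕ} (z : Fin n → ℂ) (w : ℂ) :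
    (nodePoly z).eval w = ∏ j, (w - z j) := by
  simp [nodePoly, eval_prod]

theorem eval_nodePoly_ne_zero {n : ℕ} {z : Fin n → ℂ} {α : EReal} {β : ℝ}
    (hz : ∀ j, z j ∉ complexCut α β) {x : ℝ} (hx : x ∈ realCut α β) :
    (nodePoly z).eval (x : ℂ) ≠ 0 := by
  rw [eval_nodePoly, Finset.prod_ne_zero_iff]
  exact fun j _ h => hz j ⟨x, hx, sub_eq_zero.1 h⟩

/-- On the cut `ω` is real and of constant sign. -/
theorem exists_sign_nodePoly {n : ℕ} {z : Fin n → ℂ} {α : EReal} {β : ℝ}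
    (hz : ∀ j, z j ∉ complexCut α β) (hconj : ∀ w : ℂ, pointMult z (conj w) = pointMult z w) :
    ∃ σ : ℂ, σ * σ = 1 ∧ ∀ x ∈ realCut α β,
      (nodePoly z).eval (x : ℂ) = σ * ‖(nodePoly z).eval (x : ℂ)‖ := by
  have him : ∀ x : ℝ, (((nodePoly z).eval (x : ℂ)).re : ℂ) = (nodePoly z).eval (x : ℂ) := by
    intro x
    refine Complex.conj_eq_iff_re.1 ?_
    rw [eval_nodePoly, map_prod, ← prod_comp_conj hconj fun w => (x : ℂ) - w]
    simp
  let g : ℝ → ℝ := fun x => ((nodePoly z).eval (x : ℂ)).re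
  have hg : Continuous g := by fun_prop
  have hg0 : ∀ x ∈ realCut α β, g x ≠ 0 := fun x hx h =>
    eval_nodePoly_ne_zero hz hx (by rw [← him x]; exact_mod_cast h)
  by_cases hpos : ∀ x ∈ realCut α β, 0 ≤ g x
  · refine ⟨1, by simp, fun x hx => ?_⟩
    rw [← him x, Complex.norm_real, Real.norm_of_nonneg (hpos x hx), one_mul]
  · push Not at hpos
    obtain ⟨y, hy, hgy⟩ := hpos
    refine ⟨-1, by simp, fun x hx => ?_⟩
    have hle : g x ≤ 0 := by
      by_contra hlt
      push Not at hlt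
      have hpre := (ordConnected_realCut α β).isPreconnected
      obtain ⟨c, hc, hgc⟩ := hpre.intermediate_value hy hx hg.continuousOn ⟨hgy.le, hlt.le⟩
      exact hg0 c hc hgc
    rw [← him x, Complex.norm_real, Real.norm_of_nonpos hle]
    simp [g]

/-- The measure `|ω|⁻¹ dμ`. -/
noncomputable def nodeMeasure (μ : Measure ℝ) {n : ℕ} (z : Fin n → ℂ) : Measure ℝ :=
  μ.withDensity fun x => ((‖(nodePoly z).eval (x : ℂ)‖₊⁻¹ : NNReal) : ENNReal)

theorem measurable_nodeWeight {n : ℕ} (z : Fin n → ℂ) :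
    Measurable fun x : ℝ => ‖(nodePoly z).eval (x : ℂ)‖₊⁻¹ := by
  fun_prop

theorem integral_nodeMeasure {E : Type*} [NormedAddCommGroup E] [NormedSpace ℝ E]
    (μ : Measure ℝ) {n : ℕ} (z : Fin n → ℂ) (F : ℝ → E) :
    ∫ x, F x ∂nodeMeasure μ z = ∫ x : ℝ, ‖(nodePoly z).eval (x : ℂ)‖⁻¹ • F x ∂μ :=
  integral_withDensity_eq_integral_smul (measurable_nodeWeight z) F

theorem IsMarkovMeasure.ae_mem {α : EReal} {β : ℝ} {μ : Measure ℝ} (hμ : IsMarkovMeasure α β μ) :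
    ∀ᵐ x ∂μ, x ∈ realCut α β := by
  filter_upwards [Measure.support_mem_ae (μ := μ)] with x hx using hμ.support_subset hx

theorem exists_one_add_abs_le {α : EReal} {β : ℝ} {w : ℂ} (hw : w ∉ complexCut α β) :
    ∃ c > 0, ∀ x ∈ realCut α β, 1 + |x| ≤ c * ‖(x : ℂ) - w‖ := by
  obtain ⟨d, hd, hdist⟩ := exists_le_norm_sub (isClosed_realCut α β) hw
  refine ⟨1 + (1 + ‖w‖) / d, by positivity, fun x hx => ?_⟩
  have h1 : d ≤ ‖(x : ℂ) - w‖ := by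
    rw [norm_sub_rev]; exact hdist w (Metric.mem_ball_self hd) x hx
  have h2 : |x| ≤ ‖(x : ℂ) - w‖ + ‖w‖ := by
    have := norm_add_le ((x : ℂ) - w) w
    rwa [sub_add_cancel, Complex.norm_real, Real.norm_eq_abs] at this
  have h3 : 1 + ‖w‖ ≤ (1 + ‖w‖) / d * ‖(x : ℂ) - w‖ := by
    rw [div_mul_eq_mul_div, le_div_iff₀ hd]
    gcongr
  linarith

/-- Since `∫ dμ / (1 + |x|)` is finite and `|ω(x)|` grows like `(1 + |x|) ^ 2m`, the measure
`|ω|⁻¹ dμ` has finite moments up to order `2m - 1`. -/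
theorem isMomentMeasure_nodeMeasure {α : EReal} {β : ℝ} {μ : Measure ℝ}
    (hμ : IsMarkovMeasure α β μ) (hβ : β < -1) {m : ℕ} {z : Fin (2 * m) → ℂ}
    (hz : ∀ j, z j ∉ complexCut α β) : IsMomentMeasure (realCut α β) m (nodeMeasure μ z) := by
  have hac : nodeMeasure μ z ≪ μ := withDensity_absolutelyContinuous _ _
  refine ⟨hac.ae_le hμ.ae_mem, fun k hk => ?_, fun p hp => ?_⟩
  · choose c hc0 hc using fun j => exists_one_add_abs_le (hz j)
    have hint := (hμ.integrable (-1) (notMem_complexCut_of_norm_le hβ (by simp))).norm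
    rw [nodeMeasure, integrable_withDensity_iff_integrable_smul (measurable_nodeWeight z)]
    refine Integrable.mono' (hint.const_mul (∏ j, c j)) ?_ ?_
    · exact ((measurable_nodeWeight z).smul (by fun_prop)).aestronglyMeasurable
    · filter_upwards [hμ.ae_mem] with x hx
      have hω : 0 < ‖(nodePoly z).eval (x : ℂ)‖ := norm_pos_iff.2 (eval_nodePoly_ne_zero hz hx)
      have hx1 : 0 < ‖(-1 : ℂ) - x‖ := norm_pos_iff.2
        (sub_ofReal_ne_zero (notMem_complexCut_of_norm_le (α := α) hβ (by simp)) hx)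
      have h1 : ‖(-1 : ℂ) - x‖ ≤ 1 + |x| := by
        refine (norm_sub_le _ _).trans ?_
        simp
      have h2 : |x| ^ k * ‖(-1 : ℂ) - x‖ ≤ (∏ j, c j) * ‖(nodePoly z).eval (x : ℂ)‖ := by
        calc |x| ^ k * ‖(-1 : ℂ) - x‖ ≤ (1 + |x|) ^ k * (1 + |x|) := by gcongr; linarith
          _ = (1 + |x|) ^ (k + 1) := by ring
          _ ≤ (1 + |x|) ^ (2 * m) := by
            apply pow_le_pow_right₀ (by linarith [abs_nonneg x]) (by omega)
          _ = ∏ j : Fin (2 * m), (1 + |x|) := by simp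
          _ ≤ ∏ j, (c j * ‖(x : ℂ) - z j‖) :=
            Finset.prod_le_prod (fun j _ => by positivity) fun j _ => hc j x hx
          _ = (∏ j, c j) * ‖(nodePoly z).eval (x : ℂ)‖ := by
            rw [Finset.prod_mul_distrib, eval_nodePoly, norm_prod]
      rw [norm_div, norm_one, NNReal.smul_def, NNReal.coe_inv, coe_nnnorm, smul_eq_mul, norm_mul,
        norm_inv, norm_norm, norm_pow, Real.norm_eq_abs, mul_one_div, le_div_iff₀ hx1,
        inv_mul_eq_div, div_mul_eq_mul_div, div_le_iff₀ hω]
      exact h2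
  · have h1 : ∀ᵐ x : ℝ ∂μ, p.eval (x : ℂ) = 0 := by
      rw [nodeMeasure, ae_withDensity_iff (measurable_nodeWeight z).coe_nnreal_ennreal] at hp
      filter_upwards [hp, hμ.ae_mem] with x hx hxK
      refine hx ?_
      simpa using eval_nodePoly_ne_zero hz hxK
    by_contra hp0
    have hcl : IsClosed {x : ℝ | p.eval (x : ℂ) = 0} :=
      isClosed_singleton.preimage (by fun_prop : Continuous fun x : ℝ => p.eval (x : ℂ))
    have hsub := Measure.support_subset_of_isClosed hcl h1
    refine hμ.support_infinite (Set.Finite.subset ?_ hsub)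
    exact (p.rootSet_finite ℂ).preimage Complex.ofReal_injective.injOn |>.subset fun x hx => by
      simpa [mem_rootSet, hp0] using hx

theorem markovFunction_eq_cauchyTransform {α : EReal} {β : ℝ} {μ : Measure ℝ}
    (hμ : IsMarkovMeasure α β μ) {n : ℕ} {z : Fin n → ℂ} (hz : ∀ j, z j ∉ complexCut α β) {σ : ℂ}
    (hσ : σ * σ = 1) (hsign : ∀ x ∈ realCut α β,
      (nodePoly z).eval (x : ℂ) = σ * ‖(nodePoly z).eval (x : ℂ)‖) (w : ℂ) :
    markovFunction μ w = σ * cauchyTransform (nodeMeasure μ z) (nodePoly z) w := by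
  rw [markovFunction, cauchyTransform, integral_nodeMeasure, ← integral_const_mul]
  refine integral_congr_ae ?_
  filter_upwards [hμ.ae_mem] with x hx
  have hω : (‖(nodePoly z).eval (x : ℂ)‖ : ℂ) ≠ 0 := by
    exact_mod_cast norm_ne_zero_iff.2 (eval_nodePoly_ne_zero hz hx)
  conv_rhs => enter [2, 2]; rw [hsign x hx]
  rw [Complex.real_smul, Complex.ofReal_inv, mul_div_assoc, mul_left_comm, ← mul_assoc σ σ, hσ,
    one_mul, ← mul_div_assoc, inv_mul_cancel₀ hω]

theorem integral_nodePoly_div {α : EReal} {β : ℝ} {μ : Measure ℝ}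
    (hμ : IsMarkovMeasure α β μ) (hβ : β < -1) {n : ℕ} {z : Fin n → ℂ}
    (hz : ∀ j, z j ∉ complexCut α β) :
    ∫ x : ℝ, ‖(nodePoly z).eval (x : ℂ)‖ / (-1 - x) ∂nodeMeasure μ z
      = (markovFunction μ (-1)).re := by
  have hint := hμ.integrable (-1) (notMem_complexCut_of_norm_le hβ (by simp))
  rw [markovFunction, ← RCLike.re_eq_complex_re, ← integral_re hint, integral_nodeMeasure]
  refine integral_congr_ae ?_
  filter_upwards [hμ.ae_mem] with x hx
  have hω : ‖(nodePoly z).eval (x : ℂ)‖ ≠ 0 := norm_ne_zero_iff.2 (eval_nodePoly_ne_zero hz hx)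
  rw [smul_eq_mul, ← mul_div_assoc, inv_mul_cancel₀ hω,
    show (1 : ℂ) / (-1 - (x : ℂ)) = ((1 / (-1 - x) : ℝ) : ℂ) by push_cast; rfl,
    RCLike.re_eq_complex_re, Complex.ofReal_re]

theorem diskConst_nonneg {α : EReal} {β : ℝ} {μ : Measure ℝ}
    (hμ : IsMarkovMeasure α β μ) (hβ : β < -1) : 0 ≤ diskConst β μ := by
  have hint := hμ.integrable (-1) (notMem_complexCut_of_norm_le hβ (by simp))
  rw [diskConst, markovFunction, ← RCLike.re_eq_complex_re, ← integral_re hint]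
  refine mul_nonneg (div_nonneg (by linarith) (by linarith)) (integral_nonneg_of_ae ?_)
  filter_upwards [hμ.ae_mem] with x hx
  have := hx.2
  rw [show (1 : ℂ) / (-1 - (x : ℂ)) = ((1 / (-1 - x) : ℝ) : ℂ) by push_cast; rfl,
    RCLike.re_eq_complex_re, Complex.ofReal_re, Pi.zero_apply]
  exact div_nonneg zero_le_one (by linarith)

/-! ### Rational Hermite interpolation -/

theorem num_mul_eq_mul_denom (P : ℂ[X]) {Q : ℂ[X]} (hQ : Q ≠ 0) :
    (algebraMap ℂ[X] (RatFunc ℂ) P / algebraMap ℂ[X] (RatFunc ℂ) Q).num * Q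
      = P * (algebraMap ℂ[X] (RatFunc ℂ) P / algebraMap ℂ[X] (RatFunc ℂ) Q).denom :=
  (RatFunc.num_mul_eq_mul_denom_iff hQ).2 rfl

theorem not_isRatPole_div {P Q : ℂ[X]} {w : ℂ} (hw : Q.eval w ≠ 0) :
    ¬ IsRatPole (algebraMap ℂ[X] (RatFunc ℂ) P / algebraMap ℂ[X] (RatFunc ℂ) Q) w :=
  fun h => hw (h.dvd (RatFunc.denom_div_dvd P Q))

theorem ratValue_eq_div (r : RatFunc ℂ) (w : ℂ) :
    ratValue r w = r.num.eval w / r.denom.eval w := rfl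

theorem ratValue_div {P Q : ℂ[X]} {w : ℂ} (hw : Q.eval w ≠ 0) :
    ratValue (algebraMap ℂ[X] (RatFunc ℂ) P / algebraMap ℂ[X] (RatFunc ℂ) Q) w
      = P.eval w / Q.eval w := by
  have hQ : Q ≠ 0 := by rintro rfl; simp at hw
  have h1 := congrArg (eval w) (num_mul_eq_mul_denom P hQ)
  rw [eval_mul, eval_mul] at h1
  rw [ratValue_eq_div, div_eq_div_iff (not_isRatPole_div hw) hw, h1]

theorem analyticAt_eval (p : ℂ[X]) (w : ℂ) : AnalyticAt ℂ (fun v => p.eval v) w :=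
  p.differentiable.analyticAt w

/-- Hermite interpolation by `N / D` at a point of multiplicity `n` linearizes: `D f - N` vanishes
to order `n`. -/
theorem iteratedDeriv_eq_iff_le_analyticOrderAt {f : ℂ → ℂ} {w : ℂ} (hf : AnalyticAt ℂ f w)
    {N D : ℂ[X]} (hD : D.eval w ≠ 0) (n : ℕ) :
    (∀ k < n, iteratedDeriv k (fun v => N.eval v / D.eval v) w = iteratedDeriv k f w) ↔
      (n : ℕ∞) ≤ analyticOrderAt (fun v => D.eval v * f v - N.eval v) w := by
  have hN := analyticAt_eval N w
  have hDa := analyticAt_eval D w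
  have hq : AnalyticAt ℂ (fun v => N.eval v / D.eval v) w := hN.fun_div hDa hD
  have hsub : AnalyticAt ℂ (fun v => f v - N.eval v / D.eval v) w := hf.fun_sub hq
  have h1 : (fun v => D.eval v * f v - N.eval v) =ᶠ[nhds w]
      (fun v => D.eval v) * fun v => f v - N.eval v / D.eval v := by
    filter_upwards [hDa.continuousAt.eventually_ne hD] with v hv
    simp only [Pi.mul_apply]
    field_simp
  rw [analyticOrderAt_congr h1, analyticOrderAt_mul hDa hsub,
    hDa.analyticOrderAt_eq_zero.2 hD, zero_add,
    natCast_le_analyticOrderAt_iff_iteratedDeriv_eq_zero hsub]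
  refine forall₂_congr fun k _ => ?_
  rw [iteratedDeriv_fun_sub hf.contDiffAt hq.contDiffAt, sub_eq_zero, eq_comm]

theorem le_analyticOrderAt_eval_iff {p : ℂ[X]} (hp : p ≠ 0) (w : ℂ) (n : ℕ) :
    (n : ℕ∞) ≤ analyticOrderAt (fun v => p.eval v) w ↔ n ≤ p.rootMultiplicity w := by
  obtain ⟨q, hq, hndvd⟩ := exists_eq_pow_rootMultiplicity_mul_and_not_dvd p hp w
  have h1 : (fun v => p.eval v) = (fun v => v - w) ^ p.rootMultiplicity w * fun v => q.eval v := by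
    funext v
    conv_lhs => rw [hq]
    simp
  have ha : AnalyticAt ℂ (fun v : ℂ => v - w) w := by fun_prop
  have ho : analyticOrderAt (fun v : ℂ => v - w) w = 1 := by
    have := (ha.analyticOrderAt_eq_natCast (n := 1)).2 ⟨fun _ => 1, by fun_prop, by simp, by simp⟩
    exact_mod_cast this
  rw [h1, analyticOrderAt_mul (ha.pow _) (analyticAt_eval q w), analyticOrderAt_pow ha, ho,
    (analyticAt_eval q w).analyticOrderAt_eq_zero.2 fun h => hndvd (dvd_iff_isRoot.2 h)]
  simp

/-- Existence and uniqueness of the interpolant, given a solution `(P, Q)` of the linearized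
problem with `Q` nonzero at the nodes: for another interpolant `N / D`, the polynomial `N Q - P D`
of degree `< 2m` has `2m` zeros. -/
theorem isRationalInterpolant_iff {f : ℂ → ℂ} {m : ℕ} (hm : 1 ≤ m) {z : Fin (2 * m) → ℂ}
    (hf : ∀ j, AnalyticAt ℂ f (z j)) {P Q : ℂ[X]} (hP : P.natDegree ≤ m - 1)
    (hQ : Q.natDegree ≤ m) (hQz : ∀ j, Q.eval (z j) ≠ 0)
    (hord : ∀ j, (pointMult z (z j) : ℕ∞) ≤
      analyticOrderAt (fun v => Q.eval v * f v - P.eval v) (z j)) (r : RatFunc ℂ) :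
    IsRationalInterpolant f m z r ↔
      r = algebraMap ℂ[X] (RatFunc ℂ) P / algebraMap ℂ[X] (RatFunc ℂ) Q := by
  have hQ0 : Q ≠ 0 := by
    rintro rfl
    exact hQz ⟨0, by omega⟩ (by simp)
  constructor
  · intro hr
    have hord' : ∀ j, (pointMult z (z j) : ℕ∞) ≤
        analyticOrderAt (fun v => (r.num * Q - P * r.denom).eval v) (z j) := by
      intro j
      have h1 := (iteratedDeriv_eq_iff_le_analyticOrderAt (hf j) (N := r.num)
        (hr.not_pole j) _).1 (hr.interpolates j)
      have hQa := analyticAt_eval Q (z j)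
      have hDa := analyticAt_eval r.denom (z j)
      have ha1 : AnalyticAt ℂ (fun v => Q.eval v * f v - P.eval v) (z j) :=
        (hQa.fun_mul (hf j)).fun_sub (analyticAt_eval P _)
      have ha2 : AnalyticAt ℂ (fun v => r.denom.eval v * f v - r.num.eval v) (z j) :=
        (hDa.fun_mul (hf j)).fun_sub (analyticAt_eval r.num _)
      have h2 : (fun v => (r.num * Q - P * r.denom).eval v)
          = (fun v => r.denom.eval v) * (fun v => Q.eval v * f v - P.eval v)
            - (fun v => Q.eval v) * (fun v => r.denom.eval v * f v - r.num.eval v) := by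
        funext v
        simp only [eval_sub, eval_mul, Pi.sub_apply, Pi.mul_apply]
        ring
      rw [h2]
      refine le_trans (le_min ?_ ?_) le_analyticOrderAt_sub
      · rw [analyticOrderAt_mul hDa ha1]
        exact (hord j).trans le_add_self
      · rw [analyticOrderAt_mul hQa ha2]
        exact h1.trans le_add_self
    have hT : r.num * Q - P * r.denom = 0 := by
      by_contra hT
      have hle : Finset.univ.val.map z ≤ (r.num * Q - P * r.denom).roots := by
        classical
        refine Multiset.le_iff_count.2 fun w => ?_
        rw [← pointMult_eq_count, count_roots]
        by_cases hw : ∃ j, z j = w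
        · obtain ⟨j, rfl⟩ := hw
          exact (le_analyticOrderAt_eval_iff hT _ _).1 (hord' j)
        · have : pointMult z w = 0 := by
            rw [pointMult_eq_count, Multiset.count_eq_zero]
            simpa using hw
          omega
      have hcard := (Multiset.card_le_card hle).trans (card_roots' _)
      have hdeg : (r.num * Q - P * r.denom).natDegree ≤ 2 * m - 1 := by
        refine (natDegree_sub_le _ _).trans (max_le ?_ ?_)
        · have := hr.natDegree_num_le
          exact natDegree_mul_le.trans (by omega)
        · have := hr.natDegree_denom_le
          exact natDegree_mul_le.trans (by omega)
      simp at hcard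
      omega
    rw [← RatFunc.num_div_denom r, div_eq_div_iff
      (RatFunc.algebraMap_ne_zero r.denom_ne_zero) (RatFunc.algebraMap_ne_zero hQ0),
      ← map_mul, ← map_mul, sub_eq_zero.1 hT]
  · rintro rfl
    refine ⟨?_, (natDegree_le_of_dvd (RatFunc.denom_div_dvd P Q) hQ0).trans hQ,
      fun j => not_isRatPole_div (hQz j), fun j => ?_⟩
    · rcases eq_or_ne P 0 with rfl | hP0
      · simp
      · exact (natDegree_le_of_dvd (RatFunc.num_div_dvd P hQ0) hP0).trans hP
    · have h1 := (iteratedDeriv_eq_iff_le_analyticOrderAt (hf j) (N := P) (hQz j) _).2 (hord j)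
      intro k hk
      rw [← h1 k hk]
      refine Filter.EventuallyEq.iteratedDeriv_eq k ?_
      filter_upwards [(analyticAt_eval Q (z j)).continuousAt.eventually_ne (hQz j)] with v hv
      exact ratValue_div hv

theorem pointMult_le_analyticOrderAt_nodePoly {n : ℕ} (z : Fin n → ℂ) (w : ℂ) :
    (pointMult z w : ℕ∞) ≤ analyticOrderAt (fun v => (nodePoly z).eval v) w := by
  classical
  have h0 : nodePoly z ≠ 0 := (monic_prod_of_monic _ _ fun j _ => monic_X_sub_C _).ne_zero
  have h1 : (nodePoly z).roots = Finset.univ.val.map z := by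
    have : nodePoly z = ((Finset.univ.val.map z).map fun a => X - C a).prod := by
      rw [Multiset.map_map]; rfl
    rw [this, roots_multiset_prod_X_sub_C]
  rw [le_analyticOrderAt_eval_iff h0, ← count_roots, h1, pointMult_eq_count]

/-! ### The error on the unit disk -/

/-- The interpolant together with its error estimate: each polynomial `p` of degree at most `m`
that is dominated by `ω` on the cut bounds the error on the unit disk. -/
theorem exists_interpolant_error_le {α : EReal} {β : ℝ} (hβ : β < -1)
    {μ : Measure ℝ} (hμ : IsMarkovMeasure α β μ) {m : ℕ} (hm : 1 ≤ m) {z : Fin (2 * m) → ℂ}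
    (hz : ∀ j, z j ∉ complexCut α β) (hconj : ∀ w : ℂ, pointMult z (conj w) = pointMult z w) :
    ∃ r : RatFunc ℂ,
      (∀ r' : RatFunc ℂ, IsRationalInterpolant (markovFunction μ) m z r' ↔ r' = r) ∧
      (∀ w ∉ complexCut α β, ¬ IsRatPole r w) ∧
      DifferentiableOn ℂ (fun w => markovFunction μ w - ratValue r w) (complexCut α β)ᶜ ∧
      (∀ w ∉ complexCut α β, (nodePoly z).eval w = 0 →
        markovFunction μ w - ratValue r w = 0) ∧
      ∀ (p : ℂ[X]) (M : ℝ), p.natDegree ≤ m →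
        (∀ x ∈ realCut α β, ‖p.eval (x : ℂ)‖ ^ 2 ≤ M * ‖(nodePoly z).eval (x : ℂ)‖) →
        ∀ w : ℂ, ‖w‖ ≤ 1 → ‖markovFunction μ w - ratValue r w‖ * ‖p.eval w‖ ^ 2 ≤
          ‖(nodePoly z).eval w‖ * (M * diskConst β μ) := by
  have hν := isMomentMeasure_nodeMeasure hμ hβ hz
  have hK := isClosed_realCut α β
  obtain ⟨σ, hσ, hsign⟩ := exists_sign_nodePoly hz hconj
  obtain ⟨Q₀, hQd, hQ0, horth⟩ := exists_orthogonal_polynomial hν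
  set Q := Q₀.map Complex.ofRealHom with hQdef
  have hQd' : Q.natDegree = m := by
    rw [hQdef, natDegree_map_eq_of_injective Complex.ofRealHom.injective, hQd]
  have hQ0' : Q ≠ 0 := (Polynomial.map_ne_zero_iff Complex.ofRealHom.injective).2 hQ0
  have hQroot : ∀ w ∉ complexCut α β, Q.eval w ≠ 0 := fun w hw h => by
    obtain ⟨x, hx, hxw⟩ := root_mem_of_orthogonal hν (ordConnected_realCut α β) hQd'.le hQ0' horth h
    exact hw ⟨x, hx, hxw⟩
  obtain ⟨P₀, hP₀, hPz⟩ := exists_interpolant_numerator hν hm hK hQd'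
    (natDegree_nodePoly z).le horth
  set J := cauchyTransform (nodeMeasure μ z) Q with hJ
  have hmain : ∀ w ∉ complexCut α β, Q.eval w * markovFunction μ w - (C σ * P₀).eval w
      = σ * (nodePoly z).eval w * J w := by
    intro w hw
    rw [markovFunction_eq_cauchyTransform hμ hz hσ hsign, eval_mul, eval_C]
    linear_combination σ * hPz w hw
  have hP : (C σ * P₀).natDegree ≤ m - 1 := (natDegree_C_mul_le _ _).trans hP₀
  set P := C σ * P₀
  have hJd : DifferentiableOn ℂ J (complexCut α β)ᶜ :=
    differentiableOn_cauchyTransform hν hm hK (by omega)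
  have herr : ∀ w ∉ complexCut α β, markovFunction μ w - P.eval w / Q.eval w
      = σ * (nodePoly z).eval w * J w / Q.eval w := by
    intro w hw
    have h := hQroot w hw
    rw [← hmain w hw]
    field_simp
  have herrd : DifferentiableOn ℂ (fun w => σ * (nodePoly z).eval w * J w / Q.eval w)
      (complexCut α β)ᶜ :=
    ((((nodePoly z).differentiable.differentiableOn).const_mul σ).fun_mul hJd).fun_div
      Q.differentiable.differentiableOn hQroot
  have hfd : DifferentiableOn ℂ (markovFunction μ) (complexCut α β)ᶜ := by
    refine (herrd.fun_add (P.differentiable.differentiableOn.fun_div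
      Q.differentiable.differentiableOn hQroot)).congr fun w hw => ?_
    rw [← herr w hw]; ring
  have hopen := isOpen_compl_complexCut α β
  have hrv : ∀ w ∉ complexCut α β, markovFunction μ w -
      ratValue (algebraMap ℂ[X] (RatFunc ℂ) P / algebraMap ℂ[X] (RatFunc ℂ) Q) w
      = σ * (nodePoly z).eval w * J w / Q.eval w := fun w hw => by
    rw [ratValue_div (hQroot w hw), herr w hw]
  refine ⟨algebraMap ℂ[X] (RatFunc ℂ) P / algebraMap ℂ[X] (RatFunc ℂ) Q, ?_,
    fun w hw => not_isRatPole_div (hQroot w hw), herrd.congr hrv, fun w hw h0 => ?_, ?_⟩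
  · refine isRationalInterpolant_iff hm (fun j => hfd.analyticAt (hopen.mem_nhds (hz j))) hP
      hQd'.le (fun j => hQroot _ (hz j)) fun j => ?_
    have h1 : (fun w => Q.eval w * markovFunction μ w - P.eval w) =ᶠ[nhds (z j)]
        (fun w => (nodePoly z).eval w) * fun w => σ * J w := by
      filter_upwards [hopen.mem_nhds (hz j)] with w hw
      rw [hmain w hw, Pi.mul_apply]; ring
    rw [analyticOrderAt_congr h1, analyticOrderAt_mul (analyticAt_eval _ _)
      ((hJd.const_mul σ).analyticAt (hopen.mem_nhds (hz j)))]
    exact (pointMult_le_analyticOrderAt_nodePoly z (z j)).trans le_self_add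
  · rw [hrv w hw, h0]; simp
  · intro p M hp hpM w hw
    have hwK : w ∉ complexCut α β := notMem_complexCut_of_norm_le hβ hw
    have hQw := norm_pos_iff.2 (hQroot w hwK)
    have hσ1 : ‖σ‖ = 1 := by
      have h2 := congrArg norm hσ
      rw [norm_mul, norm_one] at h2
      nlinarith [norm_nonneg σ]
    have h1 := norm_cauchyTransform_le hν hm hK hβ (fun x hx => hx.2) hQd.le horth hp hw
    rw [← hQdef, ← hJ] at h1
    have hβ1 : 0 ≤ (1 - β) / (-1 - β) := div_nonneg (by linarith) (by linarith)
    have hM : ∫ x : ℝ, ‖p.eval (x : ℂ)‖ ^ 2 / (-1 - x) ∂nodeMeasure μ z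
        ≤ M * (markovFunction μ (-1)).re := by
      rw [← integral_nodePoly_div hμ hβ hz, ← integral_const_mul]
      have hout := notMem_complexCut_of_norm_le (α := α) hβ (w := -1) (by simp)
      have hnn : ∀ᵐ x ∂nodeMeasure μ z, 0 < -1 - x := by
        filter_upwards [hν.ae_mem] with x hx
        linarith [hx.2]
      have hnorm : ∀ x : ℝ, 0 < -1 - x → ‖(-1 : ℂ) - x‖ = -1 - x := fun x hx => by
        rw [show (-1 - (x : ℂ)) = ((-1 - x : ℝ) : ℂ) by push_cast; ring, Complex.norm_real,
          Real.norm_of_nonneg hx.le]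
      refine integral_mono_ae ?_ ?_ ?_
      · refine (integrable_eval_div hν hm hK hout (p := p * p)
          (natDegree_mul_le.trans (by omega))).norm.congr ?_
        filter_upwards [hnn] with x hx
        rw [norm_div, eval_mul, norm_mul, ← pow_two, hnorm x hx]
      · refine Integrable.const_mul ((integrable_eval_div hν hm hK hout
          (natDegree_nodePoly z).le).norm.congr ?_) M
        filter_upwards [hnn] with x hx
        rw [norm_div, hnorm x hx]
      · filter_upwards [hnn, hν.ae_mem] with x hx hxK
        rw [← mul_div_assoc]
        gcongr
        exact hpM x hxK
    rw [hrv w hwK, norm_div, norm_mul, norm_mul, hσ1, one_mul, div_mul_eq_mul_div,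
      div_le_iff₀ hQw, diskConst]
    calc ‖(nodePoly z).eval w‖ * ‖J w‖ * ‖p.eval w‖ ^ 2
        = ‖(nodePoly z).eval w‖ * (‖p.eval w‖ ^ 2 * ‖J w‖) := by ring
      _ ≤ ‖(nodePoly z).eval w‖ * ((1 - β) / (-1 - β) * ‖Q.eval w‖ *
          (M * (markovFunction μ (-1)).re)) := by
        exact mul_le_mul_of_nonneg_left (h1.trans (mul_le_mul_of_nonneg_left hM
          (mul_nonneg hβ1 (norm_nonneg _)))) (norm_nonneg _)
      _ = _ := by ring

/-! ### Nodes of even multiplicity -/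

theorem exists_add_self_of_even_count {ι : Type*} [DecidableEq ι] {s : Multiset ι}
    (hs : ∀ a ∈ s, Even (s.count a)) : ∃ t, s = t + t := by
  refine ⟨∑ a ∈ s.toFinset, Multiset.replicate (s.count a / 2) a, Multiset.ext.2 fun a => ?_⟩
  rw [Multiset.count_add, Multiset.count_sum']
  simp only [Multiset.count_replicate]
  rw [Finset.sum_ite_eq']
  split_ifs with h
  · obtain ⟨k, hk⟩ := hs a (Multiset.mem_toFinset.1 h)
    omega
  · simpa using h

theorem bddAbove_cutValues {α : EReal} {β : ℝ} {n : ℕ} {z : Fin n → ℂ}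
    (hz : ∀ j, z j ∉ complexCut α β) : BddAbove (cutValues α β z) := by
  choose c hc0 hc using fun j => exists_one_add_abs_le (hz j)
  refine ⟨∏ j, (1 + ‖z j‖) * c j, ?_⟩
  rintro _ ⟨x, hx, rfl⟩
  simp only
  rw [norm_prod]
  refine Finset.prod_le_prod (fun j _ => norm_nonneg _) fun j _ => ?_
  have hne : 0 < ‖(x : ℂ) - z j‖ := norm_pos_iff.2 fun h => hz j ⟨x, hx, sub_eq_zero.1 h⟩
  rw [norm_div, div_le_iff₀ hne]
  calc ‖1 - (x : ℂ) * z j‖ ≤ 1 + |x| * ‖z j‖ := by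
        refine (norm_sub_le _ _).trans ?_
        simp
    _ ≤ (1 + ‖z j‖) * (1 + |x|) := by nlinarith [abs_nonneg x, norm_nonneg (z j)]
    _ ≤ (1 + ‖z j‖) * (c j * ‖(x : ℂ) - z j‖) := by gcongr; exact hc j x hx
    _ = _ := by ring

theorem cutMax_nonneg {α : EReal} {β : ℝ} {n : ℕ} (z : Fin n → ℂ) : 0 ≤ cutMax α β z :=
  Real.sSup_nonneg (by rintro _ ⟨x, -, rfl⟩; exact norm_nonneg _)

/-- The comparison polynomial `∏ (1 - x v)`, where `v` runs over the nodes with half their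
multiplicity. -/
theorem exists_half_reverse_polynomial {m : ℕ} {z : Fin (2 * m) → ℂ}
    (heven : ∀ j, Even (pointMult z (z j))) : ∃ p : ℂ[X], p.natDegree ≤ m ∧
      ∀ w : ℂ, ‖p.eval w‖ ^ 2 = ‖∏ j, (1 - w * z j)‖ := by
  classical
  obtain ⟨t, ht⟩ := exists_add_self_of_even_count (s := Finset.univ.val.map z) (by
    intro a ha
    obtain ⟨j, -, rfl⟩ := Multiset.mem_map.1 ha
    rw [← pointMult_eq_count]
    exact heven j)
  refine ⟨(t.map fun a => 1 - C a * X).prod, ?_, fun w => ?_⟩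
  · refine (natDegree_multiset_prod_le _).trans ?_
    rw [Multiset.map_map]
    have hcard : t.card = m := by
      have := congrArg Multiset.card ht
      simp at this
      omega
    refine (Multiset.sum_le_card_nsmul _ 1 ?_).trans_eq (by simp [hcard])
    intro k hk
    obtain ⟨a, -, rfl⟩ := Multiset.mem_map.1 hk
    refine (natDegree_sub_le _ _).trans (max_le (by simp) ?_)
    exact (natDegree_C_mul_le a X).trans natDegree_X_le
  · have h1 : ∏ j, (1 - w * z j) = ((Finset.univ.val.map z).map fun a => 1 - w * a).prod := by
      rw [Multiset.map_map]; rfl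
    have h2 : (eval w ∘ fun a => 1 - C a * X) = fun a => 1 - w * a := by
      funext a
      simp only [Function.comp_apply, eval_sub, eval_one, eval_mul, eval_C, eval_X, mul_comm]
    rw [h1, ht, Multiset.map_add, Multiset.prod_add, norm_mul, ← pow_two, eval_multiset_prod,
      Multiset.map_map, h2]

theorem norm_prod_one_sub_mul {n : ℕ} {z : Fin n → ℂ}
    (hconj : ∀ w : ℂ, pointMult z (conj w) = pointMult z w) {w : ℂ} (hw : ‖w‖ = 1) :
    ‖∏ j, (1 - w * z j)‖ = ‖(nodePoly z).eval w‖ := by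
  rw [eval_nodePoly, norm_prod, norm_prod, ← prod_comp_conj hconj fun a => ‖1 - w * a‖]
  refine Finset.prod_congr rfl fun j _ => ?_
  have h : (1 : ℂ) - w * conj (z j) = w * conj (w - z j) := by
    rw [map_sub, mul_sub, Complex.mul_conj, Complex.normSq_eq_norm_sq, hw]
    simp
  rw [h, norm_mul, hw, one_mul, Complex.norm_conj]

/-! ### The conformal map and nodes of arbitrary multiplicity -/

/-- The square root `s` of the Möbius map `(z - β) / (z - α)`; it maps the complement of the cut
into the right half plane, where `φ` corresponds to `(1 + s) / (1 - s)`. -/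
noncomputable def sqrtCut (α : EReal) (β : ℝ) (z : ℂ) : ℂ := cutQuotient α β z ^ (1 / 2 : ℂ)

theorem re_sqrtCut_pos {α : EReal} {β : ℝ} (hαβ : α < (β : EReal)) {z : ℂ}
    (hz : z ∉ complexCut α β) : 0 < (sqrtCut α β z).re :=
  re_cpow_half_pos (cutQuotient_mem_slitPlane hαβ hz)

theorem sqrtCut_sq (α : EReal) (β : ℝ) (z : ℂ) : sqrtCut α β z ^ 2 = cutQuotient α β z :=
  cpow_half_sq _

theorem sqrtCut_conj {α : EReal} {β : ℝ} (hαβ : α < (β : EReal)) {z : ℂ}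
    (hz : z ∉ complexCut α β) : sqrtCut α β (conj z) = conj (sqrtCut α β z) := by
  have hq : cutQuotient α β (conj z) = conj (cutQuotient α β z) := by
    unfold cutQuotient; split_ifs <;> simp
  have hh : conj (1 / 2 : ℂ) = 1 / 2 := by simp [Complex.conj_ofNat]
  rw [sqrtCut, sqrtCut, hq, Complex.conj_cpow _ _
    (Complex.mem_slitPlane_iff_arg.1 (cutQuotient_mem_slitPlane hαβ hz)).1, hh]

theorem add_ne_zero_of_re_pos {s t : ℂ} (hs : 0 < s.re) (ht : 0 < t.re) : s + t ≠ 0 := fun h => by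
  have := congrArg Complex.re h
  simp at this
  linarith

/-- In terms of `s`, the Blaschke-type factors become `(s(z_j) - s) / (s(z_j) + s)`. -/
theorem blaschkeG_eq {α : EReal} {β : ℝ} (hαβ : α < (β : EReal)) {n : ℕ} {z : Fin n → ℂ}
    (hz : ∀ j, z j ∉ complexCut α β) {w : ℂ} (hw : w ∉ complexCut α β) :
    blaschkeG α β z w =
      (∏ j, (sqrtCut α β (z j) - sqrtCut α β w)) / ∏ j, (sqrtCut α β (z j) + sqrtCut α β w) := by
  rw [blaschkeG, ← Finset.prod_div_distrib]
  refine Finset.prod_congr rfl fun j _ => ?_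
  have hs := re_sqrtCut_pos hαβ (hz j)
  have ht := re_sqrtCut_pos hαβ hw
  change ((1 - sqrtCut α β w) / (1 + sqrtCut α β w)
    - (1 - sqrtCut α β (z j)) / (1 + sqrtCut α β (z j))) /
    (1 - (1 - sqrtCut α β w) / (1 + sqrtCut α β w)
      * ((1 - sqrtCut α β (z j)) / (1 + sqrtCut α β (z j)))) = _
  set s := sqrtCut α β (z j)
  set t := sqrtCut α β w
  have h1 : 1 + s ≠ 0 := add_ne_zero_of_re_pos (by simp) hs
  have h2 : 1 + t ≠ 0 := add_ne_zero_of_re_pos (by simp) ht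
  have h3 : s + t ≠ 0 := add_ne_zero_of_re_pos hs ht
  have hnum : (1 - t) / (1 + t) - (1 - s) / (1 + s) = 2 * (s - t) / ((1 + t) * (1 + s)) := by
    field_simp; ring
  have hden : 1 - (1 - t) / (1 + t) * ((1 - s) / (1 + s))
      = 2 * (s + t) / ((1 + t) * (1 + s)) := by
    field_simp; ring
  rw [hnum, hden, div_div_div_cancel_right₀ (mul_ne_zero h2 h1),
    mul_div_mul_left _ _ two_ne_zero]

theorem norm_sub_lt_norm_conj_add {s t : ℂ} (hs : 0 < s.re) (ht : 0 < t.re) :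
    ‖s - t‖ < ‖conj s + t‖ := by
  rw [← sq_lt_sq₀ (norm_nonneg _) (norm_nonneg _), Complex.sq_norm, Complex.sq_norm,
    Complex.normSq_apply, Complex.normSq_apply]
  simp only [Complex.sub_re, Complex.add_re, Complex.sub_im, Complex.add_im, Complex.conj_re,
    Complex.conj_im]
  nlinarith [mul_pos hs ht]

theorem prod_norm_conj_sqrtCut {α : EReal} {β : ℝ} (hαβ : α < (β : EReal)) {n : ℕ} {z : Fin n → ℂ}
    (hz : ∀ j, z j ∉ complexCut α β) (hconj : ∀ w : ℂ, pointMult z (conj w) = pointMult z w)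
    (t : ℂ) : ∏ j, ‖conj (sqrtCut α β (z j)) + t‖ = ∏ j, ‖sqrtCut α β (z j) + t‖ := by
  rw [← prod_comp_conj hconj fun a => ‖sqrtCut α β a + t‖]
  exact Finset.prod_congr rfl fun j _ => by rw [sqrtCut_conj hαβ (hz j)]

/-- The single factors of `G` need not be bounded by `1` for nonreal nodes; conjugating the
denominators, which permutes them, makes the bound hold factor by factor. -/
theorem norm_blaschkeG_lt_one {α : EReal} {β : ℝ} (hαβ : α < (β : EReal)) {n : ℕ} (hn : 0 < n)
    {z : Fin n → ℂ} (hz : ∀ j, z j ∉ complexCut α β)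
    (hconj : ∀ w : ℂ, pointMult z (conj w) = pointMult z w) {w : ℂ} (hw : w ∉ complexCut α β) :
    ‖blaschkeG α β z w‖ < 1 := by
  have ht := re_sqrtCut_pos hαβ hw
  have hpos : 0 < ∏ j, ‖sqrtCut α β (z j) + sqrtCut α β w‖ := Finset.prod_pos fun j _ =>
    norm_pos_iff.2 (add_ne_zero_of_re_pos (re_sqrtCut_pos hαβ (hz j)) ht)
  rw [blaschkeG_eq hαβ hz hw, norm_div, norm_prod, norm_prod, div_lt_one hpos,
    ← prod_norm_conj_sqrtCut hαβ hz hconj]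
  have hlt : ∀ j, ‖sqrtCut α β (z j) - sqrtCut α β w‖
      < ‖conj (sqrtCut α β (z j)) + sqrtCut α β w‖ := fun j =>
    norm_sub_lt_norm_conj_add (re_sqrtCut_pos hαβ (hz j)) ht
  by_cases h0 : ∃ j, ‖sqrtCut α β (z j) - sqrtCut α β w‖ = 0
  · obtain ⟨j, hj⟩ := h0
    rw [Finset.prod_eq_zero (Finset.mem_univ j) hj, prod_norm_conj_sqrtCut hαβ hz hconj]
    exact hpos
  · push Not at h0
    exact Finset.prod_lt_prod_of_nonempty
      (fun j _ => lt_of_le_of_ne (norm_nonneg _) (h0 j).symm) (fun j _ => hlt j)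
      ⟨⟨0, hn⟩, Finset.mem_univ _⟩

theorem etaDisk_spec {α : EReal} {β : ℝ} (hαβ : α < (β : EReal)) (hβ : β < -1) {n : ℕ} (hn : 0 < n)
    {z : Fin n → ℂ} (hz : ∀ j, z j ∉ complexCut α β)
    (hconj : ∀ w : ℂ, pointMult z (conj w) = pointMult z w) :
    etaDisk α β z ∈ diskValues α β z ∧ BddAbove (diskValues α β z) ∧ etaDisk α β z < 1 := by
  have hsub : ∀ w ∈ Metric.closedBall (0 : ℂ) 1, w ∉ complexCut α β := fun w hw =>
    notMem_complexCut_of_norm_le hβ (by simpa using hw)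
  have hd := (invPhi_conformal hαβ).1
  have hlt : ∀ w ∉ complexCut α β, ‖invPhi α β w‖ < 1 := fun w hw => by
    have : invPhi α β w ∈ invPhi α β '' (complexCut α β)ᶜ := ⟨w, hw, rfl⟩
    rw [(invPhi_conformal hαβ).2.2.2] at this
    exact this.1
  have hcont : ContinuousOn (fun w => ‖blaschkeG α β z w‖) (Metric.closedBall (0 : ℂ) 1) := by
    refine ContinuousOn.norm ?_
    have hu : ContinuousOn (invPhi α β) (Metric.closedBall (0 : ℂ) 1) :=
      hd.continuousOn.mono hsub
    refine continuousOn_finsetProd _ fun j _ => (hu.sub continuousOn_const).div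
      (continuousOn_const.sub (hu.mul continuousOn_const)) fun w hw h => ?_
    have h1 := hlt w (hsub w hw)
    have h2 := hlt (z j) (hz j)
    have h3 : ‖invPhi α β w * invPhi α β (z j)‖ = 1 := by rw [← sub_eq_zero.1 h, norm_one]
    rw [norm_mul] at h3
    nlinarith [norm_nonneg (invPhi α β w), norm_nonneg (invPhi α β (z j))]
  have hcomp : IsCompact (diskValues α β z) := (isCompact_closedBall _ _).image_of_continuousOn hcont
  have hne : (diskValues α β z).Nonempty := ⟨_, 0, by simp, rfl⟩
  have hmem := hcomp.sSup_mem hne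
  refine ⟨hmem, hcomp.bddAbove, ?_⟩
  obtain ⟨w, hw, hweq⟩ := hmem
  rw [etaDisk, ← hweq]
  exact norm_blaschkeG_lt_one hαβ hn hz hconj (hsub w hw)

theorem eval_add_eval_neg {m : ℕ} {A : ℂ[X]} (hA : A.natDegree ≤ 2 * m) (t : ℂ) :
    A.eval t + A.eval (-t) = 2 * ∑ k ∈ Finset.range (m + 1), A.coeff (2 * k) * (t ^ 2) ^ k := by
  have h : ∀ m : ℕ, ∑ i ∈ Finset.range (2 * m + 1), A.coeff i * (t ^ i + (-t) ^ i)
      = 2 * ∑ k ∈ Finset.range (m + 1), A.coeff (2 * k) * (t ^ 2) ^ k := by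
    intro m
    induction m with
    | zero => simp; ring
    | succ m ih =>
      rw [show 2 * (m + 1) + 1 = 2 * m + 1 + 1 + 1 by ring, Finset.sum_range_succ,
        Finset.sum_range_succ, ih, Finset.sum_range_succ _ (m + 1), mul_add]
      have h1 : (-t) ^ (2 * m + 1) = -t ^ (2 * m + 1) := Odd.neg_pow ⟨m, rfl⟩ t
      have h2 : (-t) ^ (2 * m + 1 + 1) = t ^ (2 * m + 1 + 1) := Even.neg_pow ⟨m + 1, by ring⟩ t
      rw [h1, h2, ← pow_mul, show 2 * (m + 1) = 2 * m + 1 + 1 by ring]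
      ring
  rw [← h, eval_eq_sum_range' (Nat.lt_succ_of_le hA), eval_eq_sum_range' (Nat.lt_succ_of_le hA),
    ← Finset.sum_add_distrib]
  exact Finset.sum_congr rfl fun i _ => by ring

/-- The Möbius map as a quotient of affine functions, uniformly in `α`: the denominator `ε z - a`
is `z - α` or `1`. -/
theorem cutQuotient_eq_affine_div {α : EReal} {β : ℝ} (hαβ : α < (β : EReal)) :
    ∃ ε a : ℝ, 0 < ε * β - a ∧ (∀ x ∈ realCut α β, 0 ≤ ε * x - a) ∧
      ∀ w ∉ complexCut α β, (ε : ℂ) * w - a ≠ 0 ∧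
        cutQuotient α β w = (w - β) / ((ε : ℂ) * w - a) := by
  induction α using EReal.rec with
  | bot => exact ⟨0, -1, by simp, by simp, by simp [cutQuotient]⟩
  | top => exact absurd hαβ (by simp)
  | coe a =>
    have hab : a < β := by exact_mod_cast hαβ
    refine ⟨1, a, by linarith, fun x hx => ?_, fun w hw => ⟨fun h => ?_, ?_⟩⟩
    · have : a ≤ x := by exact_mod_cast hx.1
      linarith
    · exact hw ⟨a, ⟨le_refl _, hab.le⟩, by simp at h; exact (sub_eq_zero.1 h).symm⟩
    · simp [cutQuotient]

/-- The comparison polynomial for arbitrary nodes. The function `∏ (s(z_j) + s) + ∏ (s(z_j) - s)`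
is even in `s`, hence a polynomial of degree `m` in `s² = (z - β) / (z - α)`, and `p` is obtained
by clearing the denominator. On the cut `s` is imaginary and both products have the same
modulus. -/
theorem exists_blaschke_polynomial {α : EReal} {β : ℝ} (hαβ : α < (β : EReal)) {m : ℕ}
    {z : Fin (2 * m) → ℂ} (hz : ∀ j, z j ∉ complexCut α β)
    (hconj : ∀ w : ℂ, pointMult z (conj w) = pointMult z w) :
    ∃ (p : ℂ[X]) (κ : ℝ), 0 < κ ∧ p.natDegree ≤ m ∧
      (∀ x ∈ realCut α β, ‖p.eval (x : ℂ)‖ ^ 2 ≤ κ * ‖(nodePoly z).eval (x : ℂ)‖) ∧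
      ∀ w ∉ complexCut α β, 4 * ‖p.eval w‖ ^ 2 * ‖blaschkeG α β z w‖
        = κ * ‖(nodePoly z).eval w‖ * ‖1 + blaschkeG α β z w‖ ^ 2 := by
  obtain ⟨ε, a, hpos, hK, hq⟩ := cutQuotient_eq_affine_div hαβ
  let s : Fin (2 * m) → ℂ := fun j => sqrtCut α β (z j)
  let d : ℂ → ℂ := fun w => (ε : ℂ) * w - a
  have hd : ∀ j, d (z j) ≠ 0 := fun j => (hq _ (hz j)).1
  let κ : ℝ := ∏ j, ‖((ε * β - a : ℝ) : ℂ) / d (z j)‖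
  have hκ : 0 < κ := Finset.prod_pos fun j _ =>
    norm_pos_iff.2 (div_ne_zero (by exact_mod_cast hpos.ne') (hd j))
  have hprod : ∀ w : ℂ, ∏ j, ‖s j ^ 2 * d w - (w - β)‖ = κ * ‖(nodePoly z).eval w‖ := by
    intro w
    rw [eval_nodePoly, norm_prod, ← Finset.prod_mul_distrib]
    refine Finset.prod_congr rfl fun j _ => ?_
    have h0 := hd j
    rw [← norm_mul, ← norm_neg]
    congr 1
    simp only [s]
    rw [sqrtCut_sq, (hq _ (hz j)).2]
    change -((z j - β) / d (z j) * d w - (w - β)) = _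
    push_cast
    field_simp
    simp only [d]
    ring
  let A : ℂ[X] := ∏ j, (X + C (s j))
  have hAm : A.Monic := monic_prod_of_monic _ _ fun j _ => monic_X_add_C _
  have hAd : A.natDegree = 2 * m := by
    rw [natDegree_prod_of_monic _ _ fun j _ => monic_X_add_C _]
    simp
  have hAt : ∀ t, A.eval t = ∏ j, (s j + t) := fun t => by
    simp [A, eval_prod, add_comm]
  have hAt' : ∀ t, A.eval (-t) = ∏ j, (s j - t) := fun t => by
    rw [hAt]; simp [sub_eq_add_neg]
  let p : ℂ[X] := ∑ k ∈ Finset.range (m + 1),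
    C (A.coeff (2 * k)) * (X - C (β : ℂ)) ^ k * (C (ε : ℂ) * X - C (a : ℂ)) ^ (m - k)
  have hpw : ∀ w, p.eval w = ∑ k ∈ Finset.range (m + 1),
      A.coeff (2 * k) * (w - β) ^ k * d w ^ (m - k) := fun w => by
    simp [p, eval_finsetSum, d]
  have hpd : p.natDegree ≤ m := by
    refine natDegree_sum_le_of_forall_le _ _ fun k hk => ?_
    have hk' := Finset.mem_range.1 hk
    have h1 : ((X - C (β : ℂ)) ^ k).natDegree ≤ k := by
      exact natDegree_pow_le.trans (by simp)
    have h2 : (C (ε : ℂ) * X - C (a : ℂ)).natDegree ≤ 1 :=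
      (natDegree_sub_le _ _).trans
        (max_le ((natDegree_C_mul_le _ _).trans natDegree_X_le) (by simp))
    have h3 : ((C (ε : ℂ) * X - C (a : ℂ)) ^ (m - k)).natDegree ≤ m - k :=
      natDegree_pow_le.trans (by nlinarith)
    have h4 : (C (A.coeff (2 * k)) * (X - C (β : ℂ)) ^ k).natDegree ≤ k :=
      (natDegree_C_mul_le _ _).trans h1
    exact natDegree_mul_le.trans (by omega)
  have hpt : ∀ w t, d w * t ^ 2 = w - β →
      2 * p.eval w = d w ^ m * (∏ j, (s j + t) + ∏ j, (s j - t)) := by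
    intro w t ht
    rw [← hAt, ← hAt', eval_add_eval_neg hAd.le, hpw, mul_left_comm, Finset.mul_sum (a := d w ^ m)]
    congr 1
    refine Finset.sum_congr rfl fun k hk => ?_
    have hk' := Finset.mem_range.1 hk
    rw [← ht, mul_pow, show m = k + (m - k) by omega, pow_add, Nat.add_sub_cancel_left]
    ring
  have hprodt : ∀ w t, d w * t ^ 2 = w - β →
      ‖d w‖ ^ (2 * m) * (‖∏ j, (s j + t)‖ * ‖∏ j, (s j - t)‖) = κ * ‖(nodePoly z).eval w‖ := by
    intro w t ht
    rw [← hprod, ← norm_mul, ← Finset.prod_mul_distrib, norm_prod]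
    have : ‖d w‖ ^ (2 * m) = ∏ _j : Fin (2 * m), ‖d w‖ := by simp
    rw [this, ← Finset.prod_mul_distrib]
    refine Finset.prod_congr rfl fun j _ => ?_
    rw [← norm_mul, ← ht]
    congr 1
    ring
  refine ⟨p, κ, hκ, hpd, fun x hx => ?_, fun w hw => ?_⟩
  · rcases (hK x hx).eq_or_lt with h0 | h0
    · -- at the end point `α`, where `s` is infinite, only the leading coefficient contributes
      have hd0 : d x = 0 := by simp only [d]; exact_mod_cast h0.symm
      have h1 : p.eval (x : ℂ) = ((x : ℂ) - β) ^ m := by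
        rw [hpw, Finset.sum_range_succ, Finset.sum_eq_zero, hd0]
        · have : A.coeff (2 * m) = 1 := by rw [← hAd]; exact hAm
          simp [this]
        · intro k hk
          have := Finset.mem_range.1 hk
          rw [hd0, zero_pow (by omega), mul_zero]
      rw [h1, ← hprod, hd0]
      simp [← pow_mul, mul_comm m, norm_sub_rev (x : ℂ) β]
    · let y : ℝ := √(-((x - β) / (ε * x - a)))
      have hy : y ^ 2 = -((x - β) / (ε * x - a)) :=
        Real.sq_sqrt (neg_nonneg.2 (div_nonpos_of_nonpos_of_nonneg (by linarith [hx.2]) h0.le))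
      have ht : d x * (Complex.I * y) ^ 2 = (x : ℂ) - β := by
        have hdx : d x = ((ε * x - a : ℝ) : ℂ) := by simp [d]
        rw [mul_pow, Complex.I_sq, hdx]
        have h1 : (y : ℂ) ^ 2 = ((-((x - β) / (ε * x - a)) : ℝ) : ℂ) := by
          rw [← hy]; push_cast; rfl
        rw [h1, ← Complex.ofReal_one, ← Complex.ofReal_neg, ← Complex.ofReal_mul,
          ← Complex.ofReal_mul, ← Complex.ofReal_sub]
        congr 1
        field_simp
      have hsame : ‖∏ j, (s j - Complex.I * y)‖ = ‖∏ j, (s j + Complex.I * y)‖ := by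
        rw [norm_prod, norm_prod]
        refine Eq.trans ?_ (prod_norm_conj_sqrtCut hαβ hz hconj (Complex.I * y))
        refine Finset.prod_congr rfl fun j _ => ?_
        rw [← Complex.norm_conj]
        congr 1
        simp [s]
      have h1 := congrArg norm (hpt x _ ht)
      have h2 := hprodt x _ ht
      rw [hsame] at h2
      rw [norm_mul, norm_mul, norm_pow, Complex.norm_ofNat] at h1
      have h3 : ‖∏ j, (s j + Complex.I * y) + ∏ j, (s j - Complex.I * y)‖
          ≤ 2 * ‖∏ j, (s j + Complex.I * y)‖ := by
        refine (norm_add_le _ _).trans_eq ?_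
        rw [hsame]; ring
      have h4 : ‖p.eval (x : ℂ)‖ ≤ ‖d x‖ ^ m * ‖∏ j, (s j + Complex.I * y)‖ := by
        have : 0 ≤ ‖d x‖ ^ m := by positivity
        nlinarith [mul_le_mul_of_nonneg_left h3 this]
      calc ‖p.eval (x : ℂ)‖ ^ 2 ≤ (‖d x‖ ^ m * ‖∏ j, (s j + Complex.I * y)‖) ^ 2 := by gcongr
        _ = ‖d x‖ ^ (2 * m) * (‖∏ j, (s j + Complex.I * y)‖ * ‖∏ j, (s j + Complex.I * y)‖) := by
          ring
        _ = _ := h2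
  · have ht : d w * sqrtCut α β w ^ 2 = w - β := by
      rw [sqrtCut_sq, (hq w hw).2, mul_div_cancel₀ _ (hq w hw).1]
    have hne : ∏ j, (s j + sqrtCut α β w) ≠ 0 := Finset.prod_ne_zero_iff.2 fun j _ =>
      add_ne_zero_of_re_pos (re_sqrtCut_pos hαβ (hz j)) (re_sqrtCut_pos hαβ hw)
    have h1 := congrArg norm (hpt w _ ht)
    have h2 := hprodt w _ ht
    rw [norm_mul, norm_mul, norm_pow, Complex.norm_ofNat] at h1
    have hG : blaschkeG α β z w
        = (∏ j, (s j - sqrtCut α β w)) / ∏ j, (s j + sqrtCut α β w) := blaschkeG_eq hαβ hz hw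
    have h3 : 1 + blaschkeG α β z w = (∏ j, (s j + sqrtCut α β w) + ∏ j, (s j - sqrtCut α β w))
        / ∏ j, (s j + sqrtCut α β w) := by
      rw [hG]; field_simp
    have hne' := norm_ne_zero_iff.2 hne
    rw [← h2, h3, hG, norm_div, norm_div]
    have h4 : 4 * ‖p.eval w‖ ^ 2 = (‖d w‖ ^ m *
        ‖∏ j, (s j + sqrtCut α β w) + ∏ j, (s j - sqrtCut α β w)‖) ^ 2 := by
      rw [← h1]; ring
    rw [h4]
    field_simp
    ring

theorem norm_le_of_mul_norm_one_add_sq_le {e c η : ℝ} {G : ℂ} (hc : 0 ≤ c) (he : 0 ≤ e)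
    (hG : ‖G‖ ≤ η) (hη : η < 1) (h : e * ‖1 + G‖ ^ 2 ≤ 4 * ‖G‖ * c) :
    e ≤ c * (4 * η / (1 - η) ^ 2) := by
  have h1 : 1 - η ≤ ‖1 + G‖ := by
    have := norm_sub_norm_le (1 : ℂ) (-G)
    rw [norm_one, norm_neg, sub_neg_eq_add] at this
    linarith
  have h2 : 0 < 1 - η := by linarith
  rw [← mul_div_assoc, le_div_iff₀ (by positivity)]
  calc e * (1 - η) ^ 2 ≤ e * ‖1 + G‖ ^ 2 := by gcongr
    _ ≤ 4 * ‖G‖ * c := h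
    _ ≤ 4 * η * c := by gcongr
    _ = c * (4 * η) := by ring

theorem theorem2p6 (α : EReal) (β : ℝ) (hαβ : α < (β : EReal)) (hβ : β < -1)
    (μ : Measure ℝ) (hμ : IsMarkovMeasure α β μ)
    (m : ℕ) (hm : 1 ≤ m) (z : Fin (2 * m) → ℂ) (hz : ∀ j, z j ∉ complexCut α β)
    (hconj : ∀ w : ℂ, pointMult z (conj w) = pointMult z w) :
    ∃ r : RatFunc ℂ,
      -- the rational interpolant exists and is unique
      (∀ r' : RatFunc ℂ, IsRationalInterpolant (markovFunction μ) m z r' ↔ r' = r) ∧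
      -- it has no pole in the closed unit disk
      (∀ w ∈ Metric.closedBall (0 : ℂ) 1, ¬ IsRatPole r w) ∧
      -- interpolation points of even multiplicity
      ((∀ j, Even (pointMult z (z j))) →
        BddAbove (cutValues α β z) ∧
        ∀ w ∈ Metric.closedBall (0 : ℂ) 1,
          ‖markovFunction μ w - ratValue r w‖ ≤ diskConst β μ * cutMax α β z) ∧
      -- interpolation points of arbitrary multiplicity
      (etaDisk α β z ∈ diskValues α β z ∧ BddAbove (diskValues α β z) ∧ etaDisk α β z < 1 ∧
        ∀ w ∈ Metric.closedBall (0 : ℂ) 1,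
          ‖markovFunction μ w - ratValue r w‖ ≤
            diskConst β μ * (4 * etaDisk α β z / (1 - etaDisk α β z) ^ 2)) := by
  obtain ⟨r, hr, hpole, hdiff, hzero, hbound⟩ := exists_interpolant_error_le hβ hμ hm hz hconj
  have hcut : ∀ w ∈ Metric.closedBall (0 : ℂ) 1, w ∉ complexCut α β := fun w hw =>
    notMem_complexCut_of_norm_le hβ (by simpa using hw)
  have hC := diskConst_nonneg hμ hβ
  refine ⟨r, hr, fun w hw => hpole w (hcut w hw), fun heven => ?_, ?_⟩
  · have hbdd := bddAbove_cutValues hz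
    refine ⟨hbdd, fun w hw => ?_⟩
    obtain ⟨p, hp, hpw⟩ := exists_half_reverse_polynomial heven
    have hM : ∀ x ∈ realCut α β,
        ‖p.eval (x : ℂ)‖ ^ 2 ≤ cutMax α β z * ‖(nodePoly z).eval (x : ℂ)‖ := by
      intro x hx
      have h1 : ‖∏ j, (1 - (x : ℂ) * z j) / ((x : ℂ) - z j)‖ ≤ cutMax α β z :=
        le_csSup hbdd ⟨x, hx, rfl⟩
      rw [Finset.prod_div_distrib, norm_div, ← hpw, ← eval_nodePoly,
        div_le_iff₀ (norm_pos_iff.2 (eval_nodePoly_ne_zero hz hx))] at h1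
      exact h1
    -- on the unit circle `|p|² = |ω|`; the bound extends inside by the maximum principle
    refine Complex.norm_le_of_forall_mem_frontier_norm_le Metric.isBounded_ball
      (hdiff.diffContOnCl_ball (c := 0) (R := 1) hcut) (fun v hv => ?_)
      (by rwa [closure_ball _ one_ne_zero])
    rw [frontier_ball _ one_ne_zero] at hv
    have hv1 : ‖v‖ = 1 := by simpa using hv
    have h1 := hbound p _ hp hM v hv1.le
    rw [hpw, norm_prod_one_sub_mul hconj hv1] at h1
    rcases (norm_nonneg ((nodePoly z).eval v)).eq_or_lt with h0 | h0
    · rw [hzero v (notMem_complexCut_of_norm_le hβ hv1.le) (norm_eq_zero.1 h0.symm), norm_zero]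
      exact mul_nonneg hC (cutMax_nonneg z)
    · rw [mul_comm, mul_comm (cutMax α β z)] at h1
      exact le_of_mul_le_mul_left h1 h0
  · obtain ⟨hmem, hbdd, hlt⟩ := etaDisk_spec hαβ hβ (by omega) hz hconj
    refine ⟨hmem, hbdd, hlt, fun w hw => ?_⟩
    obtain ⟨p, κ, hκ, hp, hpK, hpG⟩ := exists_blaschke_polynomial hαβ hz hconj
    have hG : ‖blaschkeG α β z w‖ ≤ etaDisk α β z := le_csSup hbdd ⟨w, hw, rfl⟩
    refine norm_le_of_mul_norm_one_add_sq_le hC (norm_nonneg _) hG hlt ?_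
    rcases (norm_nonneg ((nodePoly z).eval w)).eq_or_lt with h0 | h0
    · rw [hzero w (hcut w hw) (norm_eq_zero.1 h0.symm), norm_zero, zero_mul]
      positivity
    · have h1 := hbound p κ hp hpK w (by simpa using hw)
      refine le_of_mul_le_mul_left ?_ (mul_pos hκ h0)
      calc κ * ‖(nodePoly z).eval w‖ *
            (‖markovFunction μ w - ratValue r w‖ * ‖1 + blaschkeG α β z w‖ ^ 2)
          = 4 * ‖blaschkeG α β z w‖ *
            (‖markovFunction μ w - ratValue r w‖ * ‖p.eval w‖ ^ 2) := by
            linear_combination (-‖markovFunction μ w - ratValue r w‖) * hpG w (hcut w hw)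
        _ ≤ 4 * ‖blaschkeG α β z w‖ * (‖(nodePoly z).eval w‖ * (κ * diskConst β μ)) := by gcongr
        _ = _ := by ring
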